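/- **Setting.** Let $n,N\ge 1$ and let $\mathcal G(t)$, $t\ge 0$, be a measurably time-varying undirected simple graph on $\{1,\dots,n\}$ with $n_e(t)$ edges, arbitrarily oriented; $D(t)\in\mathbb R^{n\times n_e(t)}$ is its oriented incidence matrix ($+1$ at the source, $-1$ at the sink of an edge) and $L(t)=D(t)D(t)^\top$. Let $C_i(t)\in\mathbb R^{N_y\times N}$ ($1\le i\le n$) be measurable regressors, $\bar C=\mathrm{diag}(C_1,\dots,C_n)$, let $\alpha>0$, let $\Gamma_1,\dots,\Gamma_n\in\mathbb R^{N\times N}$, $\bar\Gamma=\mathrm{diag}(\Gamma_1,\dots,\Gamma_n)$, and $$\bar\Lambda(t)=\begin{bmatrix}\bar C(t)\\ \sqrt\alpha\,D(t)^\top\otimes I_N\end{bmatrix}.$$ Let $\Delta_1\in\mathbb R^{N\times r}$, $\bar D_1=\mathbf 1_n\otimes\Delta_1$, and let $\bar D_2(t)\in\mathbb R^{(nN_y+Nn_e(t))\times r}$ (with $\bar\Lambda^\top\bar D_2$ and $\bar D_2^\top\bar D_2$ measurable in $t$). For a disturbance $\delta\in\mathcal L_2(r,[0,\infty))$ consider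 the disturbed error dynamics with performance output $$\dot{\tilde x}=-\bar\Gamma\bar\Lambda^\top\bar\Lambda\,\tilde x+(\bar\Gamma\bar\Lambda^\top\bar D_2-\bar D_1)\,\delta,\qquad z=Q\tilde x+W\delta ,\qquad t\ge 0,$$ where $Q\in\mathbb R^{p\times nN}$ and $W\in\mathbb R^{p\times r}$ satisfy $W^\top W=I_r$, $Q^\top W=0$; solutions are absolutely continuous. Inequalities between symmetric matrices are in the Loewner order and $\|\cdot\|$ is the spectral norm. **Assumptions.** There are constants $T,r_2,r_3,\underline\lambda>0$ and $\bar\iota_1\ge\underline\iota_1>0$ such that 1. $\bar\iota_1I_N\ge\int_{t-T}^t\sum_{i=1}^nC_i(s)^\top C_i(s)\,ds\ge\underline\iota_1I_N$ for all $t\ge T$; 2. $\|C_i(t)^\top C_i(t)\|\le r_2$ for all $t\ge0$ and all $i$; 3. for all $t\ge T$, $\int_{t-T}^tL(s)\,ds$ has exactly one zero eigenvalue (with multiplicity) and its other eigenvalues are at least $\underline\lambda$; and $\|L(t)\|\le r_3$ for all $t\ge0$. **Constants.** Let $r_4=r_2+\alpha r_3$, let $r_1$ be a number with $r_1\ge\|\bar\Gamma\|$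 (for instance $r_1=\|\bar\Gamma\|$), $\bar\iota_2=Tr_4$, $$\underline\iota_2=\min_{a\in\mathbb R^N,\ \|a\|^2\le1}\max\Big\{\alpha\underline\lambda(1-\|a\|^2),\ \tfrac{\underline\iota_1}{n}\|a\|^2-2r_2T\sqrt{\|a\|^2(1-\|a\|^2)}\Big\},$$ $\varphi_1=\tfrac12r_1^2\bar\iota_2^2$, $\varphi_2=\tfrac14(e^{2r_1\bar\iota_2}-1)-\tfrac12r_1\bar\iota_2$, and $$\bar\iota_3=\Big(\sqrt{\bar\iota_2-\underline\iota_2+\varphi_2\underline\iota_2}+\sqrt{\bar\iota_2}\Big)^2,\qquad \underline\iota_3=\begin{cases}\Big(\dfrac{\sqrt{\bar\iota_2-\underline\iota_2+\varphi_1\underline\iota_2}-\sqrt{\bar\iota_2}}{\varphi_1-1}\Big)^2,&\varphi_1\ne1,\\[2mm] \dfrac{\underline\iota_2^2}{4\bar\iota_2},&\varphi_1=1.\end{cases}$$ **Theorem.** Fix $\gamma>0$ and $\alpha>0$, and let $c_2>0$ satisfy $$\begin{bmatrix}\frac{c_2\underline\iota_3}{2}I_{nN}&-Q^\top\\-Q&I_p\end{bmatrix}>0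 .$$ Suppose that $c_1,\gamma_1,\gamma_2>0$ are such that $\gamma_1\ge\gamma_2$ and, for all $t\ge0$, $$\begin{bmatrix}\Phi_{11}&\Phi_{12}\\\Phi_{12}^\top&-\gamma_2I_{nN}\end{bmatrix}\le0,\quad \Phi_{11}=\begin{bmatrix}(-c_1+c_2T)I_{nN_y+Nn_e(t)}&0&0&0\\0&-\frac{c_2\underline\iota_3}{2}I_{nN}&Q^\top&0\\0&Q&-I_p&W\\0&0&W^\top&\phi_{44}\end{bmatrix},\quad \Phi_{12}=\begin{bmatrix}0\\0\\0\\-\frac{2c_1}{\sqrt{c_2\underline\iota_3}}\bar D_1^\top\end{bmatrix},$$ $$\phi_{44}=\frac{8c_2\bar\iota_3^2}{\underline\iota_3}\bar D_1^\top\bar D_1+\Big(c_1+\frac{8c_2\bar\iota_3^2r_4\gamma_1}{\underline\iota_3}\Big)\bar D_2(t)^\top\bar D_2(t)-\gamma I_r .$$ If $\sqrt{\gamma_1}\,I_{nN}\ge\bar\Gamma\ge\sqrt{\gamma_2}\,I_{nN}$, then for every initial value $\tilde x(0)$ the system has a solution for every $\delta\in\mathcal L_2$, and its $\mathcal L_2$-gain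 from $\delta$ to $z$ is at most $\sqrt\gamma$. Here the $\mathcal L_2$-gain is the infimum of the $g\ge0$ for which there is $b\ge0$ such that $z\in\mathcal L_2$ and $\|z\|_{\mathcal L_2}\le g\|\delta\|_{\mathcal L_2}+b$ for all $\delta\in\mathcal L_2$. -/

import Mathlib

open MeasureTheory
open scoped NNReal ENNReal Matrix Kronecker Matrix.Norms.L2Operator

noncomputable section

/- Matrices carry the induced Euclidean (spectral) norm; vectors are plain functions and Euclidean
lengths are written through the dot product. Signals are functions on `ℝ` of which only the values
at times `t ≥ 0` matter. -/

/-! ### Oriented graphs -/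

instance instFintypeEdges {n : ℕ} (G : SimpleGraph (Fin n)) : Fintype G.edgeSet :=
  Fintype.ofFinite _

/-- An orientation of a graph: a choice of source and sink for every edge. -/
structure EdgeOrientation {n : ℕ} (G : SimpleGraph (Fin n)) where
  src : G.edgeSet → Fin n
  snk : G.edgeSet → Fin n
  ends : ∀ e, s(src e, snk e) = (e : Sym2 (Fin n))

/-- Oriented incidence matrix: `+1` at the source, `-1` at the sink of an edge. -/
def EdgeOrientation.incidence {n : ℕ} {G : SimpleGraph (Fin n)} (o : EdgeOrientation G) :
    Matrix (Fin n) G.edgeSet ℝ :=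
  Matrix.of fun i e => if i = o.src e then 1 else if i = o.snk e then -1 else 0

/-! ### The sensor network and its matrices -/

/-- `n` sensors, a parameter vector in `ℝ^N`, local outputs in `ℝ^Ny`: the time-varying undirected
communication graph with an arbitrary orientation at each time, and the local regressors `C i t`. -/
structure SensorNetwork (n N Ny : ℕ) where
  graph : ℝ → SimpleGraph (Fin n)
  orient : ∀ t, EdgeOrientation (graph t)
  C : Fin n → ℝ → Matrix (Fin Ny) (Fin N) ℝ
  measurable_graph : ∀ i j, MeasurableSet {t | (graph t).Adj i j}
  measurable_C : ∀ i a b, Measurable fun t => C i t a b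

namespace SensorNetwork

variable {n N Ny : ℕ} (S : SensorNetwork n N Ny)

/-- Index type of the output at time `t`; it has `n * Ny + N * n_e(t)` elements. -/
abbrev Out (t : ℝ) : Type :=
  (Fin n × Fin Ny) ⊕ ((S.graph t).edgeSet × Fin N)

def incidence (t : ℝ) : Matrix (Fin n) (S.graph t).edgeSet ℝ := (S.orient t).incidence

/-- `L(t) = D(t) D(t)ᵀ`. -/
def laplacian (t : ℝ) : Matrix (Fin n) (Fin n) ℝ := S.incidence t * (S.incidence t)ᵀ

/-- `∫_{t-T}^t L(s) ds`, entry by entry. -/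
def intLaplacian (T t : ℝ) : Matrix (Fin n) (Fin n) ℝ :=
  Matrix.of fun i j => ∫ s in (t - T)..t, S.laplacian s i j

theorem isHermitian_intLaplacian (T t : ℝ) : (S.intLaplacian T t).IsHermitian := by
  ext i j
  simp [intLaplacian, laplacian, Matrix.mul_apply, mul_comm]

/-- `∫_{t-T}^t ∑ i, C_i(s)ᵀ C_i(s) ds`, entry by entry. -/
def intRegressor (T t : ℝ) : Matrix (Fin N) (Fin N) ℝ :=
  Matrix.of fun a b => ∫ s in (t - T)..t, (∑ i, (S.C i s)ᵀ * S.C i s) a b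

/-- The block-diagonal matrix `diag(C_1(t), …, C_n(t))`. -/
def Cbar (t : ℝ) : Matrix (Fin n × Fin Ny) (Fin n × Fin N) ℝ :=
  Matrix.of fun a b => if a.1 = b.1 then S.C a.1 t a.2 b.2 else 0

/-- The output matrix, `C̄(t)` stacked on `√α D(t)ᵀ ⊗ I_N`. -/
def Lambda (α t : ℝ) : Matrix (S.Out t) (Fin n × Fin N) ℝ :=
  Matrix.fromRows (S.Cbar t)
    (Real.sqrt α • ((S.incidence t)ᵀ ⊗ₖ (1 : Matrix (Fin N) (Fin N) ℝ)))

/-- Cooperative persistent excitation, bounded regressors, and connectedness on average. -/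
structure Excited (T ι₁lo ι₁hi r₂ r₃ lam : ℝ) : Prop where
  T_pos : 0 < T
  ι₁lo_pos : 0 < ι₁lo
  ι₁lo_le : ι₁lo ≤ ι₁hi
  r₂_pos : 0 < r₂
  r₃_pos : 0 < r₃
  lam_pos : 0 < lam
  excitation_lower : ∀ t, T ≤ t →
    (S.intRegressor T t - ι₁lo • (1 : Matrix (Fin N) (Fin N) ℝ)).PosSemidef
  excitation_upper : ∀ t, T ≤ t →
    (ι₁hi • (1 : Matrix (Fin N) (Fin N) ℝ) - S.intRegressor T t).PosSemidef
  regressor_le : ∀ t, 0 ≤ t → ∀ i, ‖(S.C i t)ᵀ * S.C i t‖ ≤ r₂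
  /-- exactly one zero eigenvalue (with multiplicity), the other eigenvalues are `≥ lam` -/
  connected : ∀ t, T ≤ t → ∃ i, (S.isHermitian_intLaplacian T t).eigenvalues i = 0 ∧
    ∀ j, j ≠ i → lam ≤ (S.isHermitian_intLaplacian T t).eigenvalues j
  laplacian_le : ∀ t, 0 ≤ t → ‖S.laplacian t‖ ≤ r₃

end SensorNetwork

/-- The block-diagonal gain matrix `diag(Γ_1, …, Γ_n)`. -/
def gammaBar {n N : ℕ} (Γ : Fin n → Matrix (Fin N) (Fin N) ℝ) :
    Matrix (Fin n × Fin N) (Fin n × Fin N) ℝ :=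
  Matrix.of fun a b => if a.1 = b.1 then Γ a.1 a.2 b.2 else 0

/-- `D̄₁ = 1_n ⊗ Δ₁`. -/
def D1bar (n : ℕ) {N r : ℕ} (Δ₁ : Matrix (Fin N) (Fin r) ℝ) : Matrix (Fin n × Fin N) (Fin r) ℝ :=
  Matrix.of fun a k => Δ₁ a.2 k

/-! ### Excitation constants -/

def iota2hi (T r₄ : ℝ) : ℝ := T * r₄

/-- The minimum over `a ∈ ℝ^N`, `‖a‖² ≤ 1`, of
`max {α λ (1 - ‖a‖²), (ι₁/n) ‖a‖² - 2 r₂ T √(‖a‖² (1 - ‖a‖²))}`. -/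
def iota2lo (n N : ℕ) (T ι₁lo r₂ lam α : ℝ) : ℝ :=
  sInf ((fun a : EuclideanSpace ℝ (Fin N) =>
      max (α * lam * (1 - ‖a‖ ^ 2))
        (ι₁lo / n * ‖a‖ ^ 2 - 2 * r₂ * T * Real.sqrt (‖a‖ ^ 2 * (1 - ‖a‖ ^ 2)))) ''
    {a | ‖a‖ ^ 2 ≤ 1})

def phi1 (r₁ ι₂hi : ℝ) : ℝ := 1 / 2 * r₁ ^ 2 * ι₂hi ^ 2

def phi2 (r₁ ι₂hi : ℝ) : ℝ := 1 / 4 * (Real.exp (2 * r₁ * ι₂hi) - 1) - 1 / 2 * r₁ * ι₂hi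

def iota3hi (r₁ ι₂lo ι₂hi : ℝ) : ℝ :=
  (Real.sqrt (ι₂hi - ι₂lo + phi2 r₁ ι₂hi * ι₂lo) + Real.sqrt ι₂hi) ^ 2

/-- The value at `φ₁ = 1` is the limit of the general expression. -/
def iota3lo (r₁ ι₂lo ι₂hi : ℝ) : ℝ :=
  if phi1 r₁ ι₂hi = 1 then ι₂lo ^ 2 / (4 * ι₂hi)
  else ((Real.sqrt (ι₂hi - ι₂lo + phi1 r₁ ι₂hi * ι₂lo) - Real.sqrt ι₂hi) /
    (phi1 r₁ ι₂hi - 1)) ^ 2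

/-! ### The linear matrix inequality -/

def phi44 {O X : Type} [Fintype O] [Fintype X] {r : ℕ} (γ γ₁ c₁ c₂ ι₃lo ι₃hi r₄ : ℝ)
    (D₁ : Matrix X (Fin r) ℝ) (D₂ : Matrix O (Fin r) ℝ) : Matrix (Fin r) (Fin r) ℝ :=
  (8 * c₂ * ι₃hi ^ 2 / ι₃lo) • (D₁ᵀ * D₁)
    + (c₁ + 8 * c₂ * ι₃hi ^ 2 * r₄ * γ₁ / ι₃lo) • (D₂ᵀ * D₂)
    - γ • (1 : Matrix (Fin r) (Fin r) ℝ)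

/-- The four block rows and columns have sizes `n Ny + N n_e`, `n N`, `p`, `r`, in this order. -/
def Phi11 {O X : Type} [Fintype O] [Fintype X] [DecidableEq O] [DecidableEq X] {p r : ℕ}
    (T γ γ₁ c₁ c₂ ι₃lo ι₃hi r₄ : ℝ) (D₁ : Matrix X (Fin r) ℝ) (D₂ : Matrix O (Fin r) ℝ)
    (Q : Matrix (Fin p) X ℝ) (W : Matrix (Fin p) (Fin r) ℝ) :
    Matrix ((O ⊕ X) ⊕ (Fin p ⊕ Fin r)) ((O ⊕ X) ⊕ (Fin p ⊕ Fin r)) ℝ :=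
  Matrix.fromBlocks
    (Matrix.fromBlocks ((-c₁ + c₂ * T) • (1 : Matrix O O ℝ)) 0
      0 (-(c₂ * ι₃lo / 2) • (1 : Matrix X X ℝ)))
    (Matrix.fromBlocks 0 0 Qᵀ 0)
    (Matrix.fromBlocks 0 Q 0 0)
    (Matrix.fromBlocks (-1) W Wᵀ (phi44 γ γ₁ c₁ c₂ ι₃lo ι₃hi r₄ D₁ D₂))

def Phi12 {O X : Type} {p r : ℕ} (c₁ c₂ ι₃lo : ℝ) (D₁ : Matrix X (Fin r) ℝ) :
    Matrix ((O ⊕ X) ⊕ (Fin p ⊕ Fin r)) X ℝ :=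
  Matrix.fromRows (Matrix.fromRows 0 0)
    (Matrix.fromRows 0 (-(2 * c₁ / Real.sqrt (c₂ * ι₃lo)) • D₁ᵀ))

/-- The matrix that the tuning problem requires to be negative semidefinite. -/
def tuningMatrix {O X : Type} [Fintype O] [Fintype X] [DecidableEq O] [DecidableEq X] {p r : ℕ}
    (T γ γ₁ γ₂ c₁ c₂ ι₃lo ι₃hi r₄ : ℝ) (D₁ : Matrix X (Fin r) ℝ) (D₂ : Matrix O (Fin r) ℝ)
    (Q : Matrix (Fin p) X ℝ) (W : Matrix (Fin p) (Fin r) ℝ) :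
    Matrix (((O ⊕ X) ⊕ (Fin p ⊕ Fin r)) ⊕ X) (((O ⊕ X) ⊕ (Fin p ⊕ Fin r)) ⊕ X) ℝ :=
  Matrix.fromBlocks (Phi11 T γ γ₁ c₁ c₂ ι₃lo ι₃hi r₄ D₁ D₂ Q W) (Phi12 c₁ c₂ ι₃lo D₁)
    (Phi12 c₁ c₂ ι₃lo D₁)ᵀ (-γ₂ • (1 : Matrix X X ℝ))

/-! ### Signals, systems and the `L₂`-gain -/

/-- Square-integrable signals on `[0, ∞)`. -/
def MemL2 {ι : Type} [Fintype ι] (u : ℝ → ι → ℝ) : Prop :=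
  (∀ i, AEStronglyMeasurable (fun t => u t i) (volume.restrict (Set.Ici 0))) ∧
    IntegrableOn (fun t => u t ⬝ᵥ u t) (Set.Ici 0)

def l2norm {ι : Type} [Fintype ι] (u : ℝ → ι → ℝ) : ℝ :=
  Real.sqrt (∫ t in Set.Ici (0 : ℝ), u t ⬝ᵥ u t)

/-- The `L₂`-gain of a system given by its input-output pairs: the infimum of the `g ≥ 0` for which
there is `b ≥ 0` such that every output `z` of every `u ∈ L₂` is in `L₂` and
`‖z‖ ≤ g ‖u‖ + b`; it is `∞` if there is no such `g`. -/
def l2Gain {ι κ : Type} [Fintype ι] [Fintype κ] (H : (ℝ → ι → ℝ) → (ℝ → κ → ℝ) → Prop) : ℝ≥0∞ :=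
  ⨅ (g : ℝ≥0) (_ : ∃ b : ℝ≥0, ∀ u z, MemL2 u → H u z → MemL2 z ∧ l2norm z ≤ g * l2norm u + b),
    (g : ℝ≥0∞)

namespace SensorNetwork

variable {n N Ny : ℕ} (S : SensorNetwork n N Ny)

/-- Right-hand side of the disturbed error dynamics,
`-Γ̄ Λ̄ᵀ Λ̄ x + (Γ̄ Λ̄ᵀ D̄₂ - D̄₁) d`. -/
def errorRhs {r : ℕ} (α : ℝ) (Γ : Fin n → Matrix (Fin N) (Fin N) ℝ)
    (Δ₁ : Matrix (Fin N) (Fin r) ℝ) (D₂ : ∀ t, Matrix (S.Out t) (Fin r) ℝ)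
    (t : ℝ) (x : Fin n × Fin N → ℝ) (d : Fin r → ℝ) : Fin n × Fin N → ℝ :=
  -((gammaBar Γ * (S.Lambda α t)ᵀ * S.Lambda α t) *ᵥ x)
    + (gammaBar Γ * (S.Lambda α t)ᵀ * D₂ t - D1bar n Δ₁) *ᵥ d

/-- `x` is a (Carathéodory) solution on `[0, ∞)` of the disturbed error dynamics with initial
value `x₀` and disturbance `δ`. -/
def IsErrorTrajectory {r : ℕ} (α : ℝ) (Γ : Fin n → Matrix (Fin N) (Fin N) ℝ)
    (Δ₁ : Matrix (Fin N) (Fin r) ℝ) (D₂ : ∀ t, Matrix (S.Out t) (Fin r) ℝ)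
    (x₀ : Fin n × Fin N → ℝ) (δ : ℝ → Fin r → ℝ) (x : ℝ → Fin n × Fin N → ℝ) : Prop :=
  ∀ t, 0 ≤ t → ∀ i,
    IntervalIntegrable (fun s => S.errorRhs α Γ Δ₁ D₂ s (x s) (δ s) i) volume 0 t ∧
      x t i = x₀ i + ∫ s in (0 : ℝ)..t, S.errorRhs α Γ Δ₁ D₂ s (x s) (δ s) i

/-- The disturbed error system started at `x₀`, from `δ` to the performance output
`z = Q x + W δ`. -/
def ErrorSystem {r p : ℕ} (α : ℝ) (Γ : Fin n → Matrix (Fin N) (Fin N) ℝ)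
    (Δ₁ : Matrix (Fin N) (Fin r) ℝ) (D₂ : ∀ t, Matrix (S.Out t) (Fin r) ℝ)
    (Q : Matrix (Fin p) (Fin n × Fin N) ℝ) (W : Matrix (Fin p) (Fin r) ℝ)
    (x₀ : Fin n × Fin N → ℝ) (δ : ℝ → Fin r → ℝ) (z : ℝ → Fin p → ℝ) : Prop :=
  ∃ x, S.IsErrorTrajectory α Γ Δ₁ D₂ x₀ δ x ∧ z = fun t => Q *ᵥ x t + W *ᵥ δ t

/-- Measurability in time of the way a time-varying `D̄₂` enters (the size of `D̄₂(t)` depends on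
the number of edges, the sizes of these two products do not). -/
def MeasurableDisturbance {r : ℕ} (α : ℝ) (D₂ : ∀ t, Matrix (S.Out t) (Fin r) ℝ) : Prop :=
  (∀ i k, Measurable fun t => ((S.Lambda α t)ᵀ * D₂ t) i k) ∧
    ∀ k l, Measurable fun t => ((D₂ t)ᵀ * D₂ t) k l

end SensorNetwork

end

/-! ### Integral inequalities and absolutely continuous paths -/

/-! The proof combines a storage function with observability over windows. Put b = D̄₂δ, u = D̄₁δ, g
= Λ̄x - b, and let f = -Γ̄Λ̄ᵀg - u be the velocity. For V = c₁ xᵀΓ̄⁻¹x the gain cancels, and V' =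
c₁(-|Λ̄x|² - |g|² + |b|² - 2uᵀΓ̄⁻¹x). The term |g|² pays for a small multiple μ|f|² of the squared
velocity, up to a multiple of |u|². The cross term is split by Young's inequality and Γ̄ ≥ √γ₂.
Testing the large matrix inequality on one vector gives c₁|b|² + 4c₁²/(c₂ι₃γ₂)|u|² ≤ (γ - 1)|δ|²,
where ι₃ is the lower constant (`dissipation_of_tuningMatrix`). Hence V' + c₁|Λ̄x|² + μ|f|² ≤
(1/3)c₂ι₃|x|² + (γ - 1)|δ|² (`dissipation_le`).

The form |Λ̄x|² may be degenerate at every single time, but its Gram matrix over a window of length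
T is at least ι₂lo (`Excited.outputGram_window`). Within a window x moves only by the integral of f.
Therefore ∫|x|² is controlled by ∫|Λ̄x|², ∫|f|² and |x₀|² (`integral_quadratic_le_of_window`).
Disturbances need no separate treatment here, because they are part of f. With Young weight σ = √φ₁
the constants match, since ι₃(1 + σ)² ≤ ι₂lo (`iota3lo_le`), and adding the two estimates absorbs
(1/3)c₂ι₃∫|x|² and leaves (c₂ι₃/2)∫|x|² ≤ B + (γ - 1)∫|δ|² (`energy_add_window_le`).

Finally |z|² = |Qx|² + |δ|² and |Qx|² ≤ (c₂ι₃/2)|x|², so ∫|z|² ≤ B + γ∫|δ|² with B depending only on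
the initial value. Solutions exist by a contraction argument for the associated linear Volterra
equation (`exists_volterra`). -/

theorem sq_intervalIntegral_le {f : ℝ → ℝ} {a b : ℝ} (hab : a ≤ b)
    (hf : IntervalIntegrable f volume a b)
    (hf2 : IntervalIntegrable (fun s => f s ^ 2) volume a b) :
    (∫ s in a..b, f s) ^ 2 ≤ (b - a) * ∫ s in a..b, f s ^ 2 := by
  rcases hab.eq_or_lt with rfl | hlt
  · simp
  set I := ∫ s in a..b, f s with hI
  have hd : 0 < b - a := sub_pos.2 hlt
  -- Cauchy-Schwarz against the constant 1, obtained as nonnegativity of a variance.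
  have h0 : 0 ≤ ∫ s in a..b, ((b - a) * f s - I) ^ 2 :=
    intervalIntegral.integral_nonneg hab fun s _ => sq_nonneg _
  have hexp : ∀ s, ((b - a) * f s - I) ^ 2
      = (b - a) ^ 2 * f s ^ 2 - 2 * (b - a) * I * f s + I ^ 2 := fun s => by ring
  simp_rw [hexp] at h0
  rw [intervalIntegral.integral_add ((hf2.const_mul _).sub (hf.const_mul _)) (by simp),
    intervalIntegral.integral_sub (hf2.const_mul _) (hf.const_mul _),
    intervalIntegral.integral_const_mul, intervalIntegral.integral_const_mul,
    intervalIntegral.integral_const, ← hI, smul_eq_mul] at h0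
  have h1 : 0 ≤ (b - a) * ((b - a) * (∫ s in a..b, f s ^ 2) - I ^ 2) := by nlinarith
  have := nonneg_of_mul_nonneg_right h1 hd
  linarith

/-- Each s lies in [t - T, t] only for t in a set of length at most T. Fubini is avoided through the
primitive G of F: the double integral telescopes to the integral of G over [τ - T, τ] minus that
over [-T, 0], and 0 ≤ G ≤ G(τ). -/
theorem integral_window_le {F : ℝ → ℝ} {T τ : ℝ} (hT : 0 ≤ T) (hτ : 0 ≤ τ)
    (hF : ∀ s, 0 ≤ F s) (hi : IntervalIntegrable F volume (-T) τ) :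
    IntervalIntegrable (fun t => ∫ s in (t - T)..t, F s) volume 0 τ ∧
      ∫ t in (0 : ℝ)..τ, (∫ s in (t - T)..t, F s) ≤ T * ∫ s in (-T)..τ, F s := by
  have hTτ : -T ≤ τ := by linarith
  set G : ℝ → ℝ := fun t => ∫ s in (-T)..t, F s with hG
  have hGc : ContinuousOn G (Set.Icc (-T) τ) := by
    have := intervalIntegral.continuousOn_primitive_interval
      ((intervalIntegrable_iff_integrableOn_Icc_of_le hTτ).1 hi |>.mono_set
        (Set.uIcc_of_le hTτ).subset)
    rwa [Set.uIcc_of_le hTτ] at this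
  have hsub : ∀ {c d}, -T ≤ c → c ≤ d → d ≤ τ → IntervalIntegrable F volume c d := by
    intro c d h1 h2 h3
    refine hi.mono_set ?_
    rw [Set.uIcc_of_le h2, Set.uIcc_of_le hTτ]
    exact Set.Icc_subset_Icc h1 h3
  have hGi : ∀ {c d}, -T ≤ c → c ≤ d → d ≤ τ → IntervalIntegrable G volume c d := by
    intro c d h1 h2 h3
    refine ContinuousOn.intervalIntegrable ?_
    rw [Set.uIcc_of_le h2]
    exact hGc.mono (Set.Icc_subset_Icc h1 h3)
  have hGi' : IntervalIntegrable (fun t => G (t - T)) volume 0 τ := by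
    refine ContinuousOn.intervalIntegrable ?_
    rw [Set.uIcc_of_le hτ]
    refine hGc.comp (by fun_prop) fun t ht => ⟨by linarith [ht.1], by linarith [ht.2]⟩
  have hw : ∀ t ∈ Set.Icc 0 τ, (∫ s in (t - T)..t, F s) = G t - G (t - T) := by
    intro t ht
    rw [hG, intervalIntegral.integral_interval_sub_left]
    · exact hsub le_rfl (by linarith [ht.1]) ht.2
    · exact hsub le_rfl (by linarith [ht.1]) (by linarith [ht.2])
  have hG0 : ∀ t ∈ Set.Icc (-T) τ, 0 ≤ G t := fun t ht =>
    intervalIntegral.integral_nonneg ht.1 fun s _ => hF s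
  have hGle : ∀ t ∈ Set.Icc (-T) τ, G t ≤ G τ := by
    intro t ht
    have : G t + ∫ s in t..τ, F s = G τ := intervalIntegral.integral_add_adjacent_intervals
      (hsub le_rfl ht.1 ht.2) (hsub ht.1 ht.2 le_rfl)
    have h2 : 0 ≤ ∫ s in t..τ, F s := intervalIntegral.integral_nonneg ht.2 fun s _ => hF s
    linarith
  constructor
  · refine ((hGi (by linarith) hτ le_rfl).sub hGi').congr ?_
    intro t ht
    rw [Set.uIoc_of_le hτ] at ht
    exact (hw t ⟨ht.1.le, ht.2⟩).symm
  rw [intervalIntegral.integral_congr (g := fun t => G t - G (t - T))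
    (fun t ht => hw t (by rwa [Set.uIcc_of_le hτ] at ht)),
    intervalIntegral.integral_sub (hGi (by linarith) hτ le_rfl) hGi',
    intervalIntegral.integral_comp_sub_right (fun t => G t), zero_sub]
  have e1 := intervalIntegral.integral_add_adjacent_intervals
    (hGi le_rfl (neg_nonpos.2 hT) hτ) (hGi (neg_nonpos.2 hT) hτ le_rfl)
  have e2 := intervalIntegral.integral_add_adjacent_intervals
    (hGi le_rfl (by linarith) (by linarith : τ - T ≤ τ))
    (hGi (by linarith) (by linarith : τ - T ≤ τ) le_rfl)
  have e3 : 0 ≤ ∫ t in (-T)..0, G t := intervalIntegral.integral_nonneg (by linarith)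
    fun t ht => hG0 t ⟨ht.1, ht.2.trans hτ⟩
  have e4 : ∫ t in (τ - T)..τ, G t ≤ ∫ t in (τ - T)..τ, G τ :=
    intervalIntegral.integral_mono_on (by linarith) (hGi (by linarith) (by linarith) le_rfl)
      (by simp) fun t ht => hGle t ⟨by linarith [ht.1], ht.2⟩
  rw [intervalIntegral.integral_const, smul_eq_mul] at e4
  have : (τ - (τ - T)) * G τ = T * G τ := by ring
  linarith

/-- Product rule for absolutely continuous functions. Since u and v are controlled only on [0, τ],
the rule is applied to the primitives `U` and `V`, whose derivatives are f and g almost everywhere.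
-/
theorem mul_sub_mul_eq_integral {f g u v : ℝ → ℝ} {τ : ℝ} (hτ : 0 ≤ τ)
    (hf : IntervalIntegrable f volume 0 τ) (hg : IntervalIntegrable g volume 0 τ)
    (hu : ∀ t ∈ Set.Icc 0 τ, u t = u 0 + ∫ s in (0 : ℝ)..t, f s)
    (hv : ∀ t ∈ Set.Icc 0 τ, v t = v 0 + ∫ s in (0 : ℝ)..t, g s) :
    u τ * v τ - u 0 * v 0 = ∫ s in (0 : ℝ)..τ, (f s * v s + u s * g s) := by
  set U : ℝ → ℝ := fun t => u 0 + ∫ s in (0 : ℝ)..t, f s with hU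
  set V : ℝ → ℝ := fun t => v 0 + ∫ s in (0 : ℝ)..t, g s with hV
  have ac : ∀ {k : ℝ → ℝ} (c : ℝ), IntervalIntegrable k volume 0 τ →
      AbsolutelyContinuousOnInterval (fun t => c + ∫ s in (0 : ℝ)..t, k s) 0 τ := by
    intro k c hk
    refine AbsolutelyContinuousOnInterval.add (f := fun _ => c) ?_
      (hk.absolutelyContinuousOnInterval_intervalIntegral (by simp))
    exact ((LipschitzWith.const c).lipschitzOnWith).absolutelyContinuousOnInterval
  have key := (ac (u 0) hf).integral_deriv_mul_eq_sub (ac (v 0) hg)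
  have hm : ∀ {t}, t ∈ Set.uIcc 0 τ ↔ t ∈ Set.Icc 0 τ := by simp [Set.uIcc_of_le hτ]
  rw [hu τ ⟨hτ, le_rfl⟩, hv τ ⟨hτ, le_rfl⟩]
  simp only [intervalIntegral.integral_same, add_zero] at key
  rw [← key]
  refine intervalIntegral.integral_congr_ae ?_
  filter_upwards [hf.ae_hasDerivAt_integral, hg.ae_hasDerivAt_integral] with t h1 h2 ht
  have ht' : t ∈ Set.uIcc 0 τ := Set.uIoc_subset_uIcc ht
  rw [((h1 ht' 0 (by simp)).const_add (u 0)).deriv, ((h2 ht' 0 (by simp)).const_add (v 0)).deriv,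
    hu t (hm.1 ht'), hv t (hm.1 ht')]

theorem continuousOn_of_eq_primitive {f u : ℝ → ℝ} {τ c : ℝ} (hτ : 0 ≤ τ)
    (hf : IntervalIntegrable f volume 0 τ)
    (hu : ∀ t ∈ Set.Icc 0 τ, u t = c + ∫ s in (0 : ℝ)..t, f s) :
    ContinuousOn u (Set.Icc 0 τ) := by
  have h := intervalIntegral.continuousOn_primitive_interval
    ((intervalIntegrable_iff_integrableOn_Icc_of_le hτ).1 hf |>.mono_set
      (Set.uIcc_of_le hτ).subset)
  rw [Set.uIcc_of_le hτ] at h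
  exact ((continuousOn_const (c := c)).add h).congr fun t ht => hu t ht

theorem quadratic_sub_eq_integral {ι : Type*} [Fintype ι] (P : Matrix ι ι ℝ)
    (hP : P.IsHermitian) {x f : ℝ → ι → ℝ} {τ : ℝ} (hτ : 0 ≤ τ)
    (hf : ∀ i, IntervalIntegrable (fun s => f s i) volume 0 τ)
    (hx : ∀ i, ∀ t ∈ Set.Icc 0 τ, x t i = x 0 i + ∫ s in (0 : ℝ)..t, f s i) :
    IntervalIntegrable (fun s => 2 * (f s ⬝ᵥ (P *ᵥ x s))) volume 0 τ ∧
    x τ ⬝ᵥ (P *ᵥ x τ) - x 0 ⬝ᵥ (P *ᵥ x 0) = ∫ s in (0 : ℝ)..τ, 2 * (f s ⬝ᵥ (P *ᵥ x s)) := by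
  have hxc : ∀ i, ContinuousOn (fun t => x t i) (Set.uIcc 0 τ) := fun i => by
    rw [Set.uIcc_of_le hτ]
    exact continuousOn_of_eq_primitive hτ (hf i) (hx i)
  have hi1 : ∀ i j, IntervalIntegrable (fun s => f s i * x s j) volume 0 τ := fun i j =>
    (hf i).mul_continuousOn (hxc j)
  have hi2 : ∀ i j, IntervalIntegrable (fun s => x s i * f s j) volume 0 τ := fun i j =>
    (hf j).continuousOn_mul (hxc i)
  have hsum : ∀ a b : ι → ℝ, a ⬝ᵥ (P *ᵥ b) = ∑ i, ∑ j, P i j * (a i * b j) := by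
    intro a b
    simp only [dotProduct, Matrix.mulVec, Finset.mul_sum]
    exact Finset.sum_congr rfl fun i _ => Finset.sum_congr rfl fun j _ => by ring
  -- Symmetry of P turns each summand into the derivative of a product of two coordinates.
  have hsymm : ∀ a b : ι → ℝ, 2 * (a ⬝ᵥ (P *ᵥ b)) =
      ∑ i, ∑ j, P i j * (a i * b j + b i * a j) := by
    intro a b
    rw [two_mul]
    nth_rw 2 [hsum]
    rw [hsum, Finset.sum_comm (f := fun i j => P i j * (a i * b j)), ]
    simp only [mul_add, Finset.sum_add_distrib]
    rw [Finset.sum_comm]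
    congr 1
    rw [Finset.sum_comm]
    refine Finset.sum_congr rfl fun i _ => Finset.sum_congr rfl fun j _ => ?_
    have := hP.apply i j
    simp only [star_trivial] at this
    rw [← this]; ring
  constructor
  · refine IntervalIntegrable.const_mul ?_ 2
    simp only [hsum]
    have : IntervalIntegrable (∑ i, ∑ j, fun s => P i j * (f s i * x s j)) volume 0 τ :=
      IntervalIntegrable.sum _ fun i _ => IntervalIntegrable.sum _ fun j _ =>
        (hi1 i j).const_mul (P i j)
    refine this.congr fun s _ => ?_
    simp
  · simp only [hsymm]
    rw [intervalIntegral.integral_finsetSum]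
    swap
    · intro i _
      have : IntervalIntegrable (∑ j, fun s => P i j * (f s i * x s j + x s i * f s j))
          volume 0 τ := IntervalIntegrable.sum _ fun j _ =>
            ((hi1 i j).add (hi2 i j)).const_mul (P i j)
      refine this.congr fun s _ => ?_
      simp
    rw [hsum, hsum, ← Finset.sum_sub_distrib]
    refine Finset.sum_congr rfl fun i _ => ?_
    rw [intervalIntegral.integral_finsetSum fun j _ => ((hi1 i j).add (hi2 i j)).const_mul (P i j),
      ← Finset.sum_sub_distrib]
    refine Finset.sum_congr rfl fun j _ => ?_
    rw [intervalIntegral.integral_const_mul,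
      ← mul_sub_mul_eq_integral (u := fun t => x t i) (v := fun t => x t j) hτ (hf i) (hf j)
        (hx i) (hx j)]
    ring

/-! ### Linear Volterra equations with bounded measurable kernels -/

section Volterra

variable {ι : Type*} [Fintype ι]

/-- Banach's fixed point theorem in the weighted norm sup e^{-2Kt}|x(t)|. The integral of K e^{2Ks}
over [0, t] is at most e^{2Kt}/2, so the integral operator contracts by 1/2 on the whole half-line
at once. -/
theorem exists_volterra_of_forall_le (A : ℝ → Matrix ι ι ℝ)
    (hA : ∀ i j, Measurable fun t => A t i j) {K : ℝ} (hK : 0 < K)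
    (hAK : ∀ t, ∀ v : ι → ℝ, ‖A t *ᵥ v‖ ≤ K * ‖v‖)
    {β : ℝ → ι → ℝ} (hβ : ContinuousOn β (Set.Ici 0)) {C : ℝ}
    (hβC : ∀ t, 0 ≤ t → ‖β t‖ ≤ C * Real.exp (2 * K * t)) :
    ∃ x : ℝ → ι → ℝ, Continuous x ∧
      ∀ t, 0 ≤ t → x t = β t + ∫ s in (0 : ℝ)..t, A s *ᵥ x s := by
  have hmeas : ∀ u : ℝ → ι → ℝ, Continuous u → Measurable fun s => A s *ᵥ u s := by
    intro u hu
    refine measurable_pi_lambda _ fun i => ?_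
    simp only [Matrix.mulVec, dotProduct]
    exact Finset.measurable_sum _ fun j _ =>
      (hA i j).mul ((continuous_apply j).comp hu).measurable
  have hint : ∀ u : ℝ → ι → ℝ, Continuous u → ∀ a b,
      IntervalIntegrable (fun s => A s *ᵥ u s) volume a b := by
    intro u hu a b
    refine IntervalIntegrable.mono_fun' (g := fun s => K * ‖u s‖)
      (Continuous.intervalIntegrable (by fun_prop) _ _) (hmeas u hu).aestronglyMeasurable ?_
    exact Filter.Eventually.of_forall fun s => hAK s (u s)
  let w : BoundedContinuousFunction ℝ (ι → ℝ) → ℝ → ι → ℝ :=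
    fun u s => Real.exp (2 * K * s) • u s
  have hw : ∀ u, Continuous (w u) := fun u => by
    have := u.continuous
    fun_prop
  have hexpint : ∀ t, ∫ s in (0 : ℝ)..t, K * Real.exp (2 * K * s)
      = (Real.exp (2 * K * t) - 1) / 2 := by
    intro t
    rw [intervalIntegral.integral_const_mul,
      intervalIntegral.integral_comp_mul_left (fun s => Real.exp s) (by positivity : 2 * K ≠ 0),
      integral_exp, mul_zero, Real.exp_zero, smul_eq_mul]
    field_simp
  have hbound : ∀ (u : ℝ → ι → ℝ), Continuous u → ∀ R : ℝ,
      (∀ s, ‖u s‖ ≤ R * Real.exp (2 * K * s)) → ∀ t, 0 ≤ t →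
      ‖∫ s in (0 : ℝ)..t, A s *ᵥ u s‖ ≤ R * ((Real.exp (2 * K * t) - 1) / 2) := by
    intro u hu R hR t ht
    rw [← hexpint, ← intervalIntegral.integral_const_mul]
    refine intervalIntegral.norm_integral_le_of_norm_le ht ?_
      (Continuous.intervalIntegrable (by fun_prop) _ _)
    refine Filter.Eventually.of_forall fun s _ => (hAK s (u s)).trans ?_
    calc K * ‖u s‖ ≤ K * (R * Real.exp (2 * K * s)) := by gcongr; exact hR s
      _ = _ := by ring
  have hw_le : ∀ u s, ‖w u s‖ ≤ ‖u‖ * Real.exp (2 * K * s) := by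
    intro u s
    simp only [w]
    rw [norm_smul, Real.norm_of_nonneg (Real.exp_pos _).le, mul_comm]
    gcongr
    exact u.norm_coe_le_norm s
  -- The unknown is u = e^{-2Kt}x. Replacing t by `max t 0` freezes negative times, so that bounded
  -- continuous functions on the whole line can serve as the complete space.
  let Ψ : BoundedContinuousFunction ℝ (ι → ℝ) → ℝ → ι → ℝ := fun u t =>
    Real.exp (-(2 * K * max t 0)) • (β (max t 0) + ∫ s in (0 : ℝ)..(max t 0), A s *ᵥ w u s)
  have hΨc : ∀ u, Continuous (Ψ u) := by
    intro u
    have h1 : Continuous fun t : ℝ => β (max t 0) :=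
      hβ.comp_continuous (by fun_prop) fun t => le_max_right t 0
    have h2 : Continuous fun t : ℝ => ∫ s in (0 : ℝ)..(max t 0), A s *ᵥ w u s :=
      (intervalIntegral.continuous_primitive (hint _ (hw u)) 0).comp
        (by fun_prop : Continuous fun t : ℝ => max t 0)
    exact (by fun_prop : Continuous fun t : ℝ => Real.exp (-(2 * K * max t 0))).smul (h1.add h2)
  have hΨb : ∀ u t, ‖Ψ u t‖ ≤ C + ‖u‖ := by
    intro u t
    have ht : 0 ≤ max t 0 := le_max_right t 0
    simp only [Ψ]
    rw [norm_smul, Real.norm_of_nonneg (Real.exp_pos _).le, Real.exp_neg,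
      inv_mul_le_iff₀ (Real.exp_pos _)]
    refine (norm_add_le _ _).trans ?_
    have h1 := hβC _ ht
    have h2 := hbound _ (hw u) _ (hw_le u) _ ht
    have h3 := norm_nonneg u
    have h4 := Real.exp_pos (2 * K * max t 0)
    nlinarith
  let Φ : BoundedContinuousFunction ℝ (ι → ℝ) → BoundedContinuousFunction ℝ (ι → ℝ) := fun u =>
    BoundedContinuousFunction.ofNormedAddCommGroup (Ψ u) (hΨc u) (C + ‖u‖) (hΨb u)
  have hΦ : ContractingWith (1 / 2) Φ := by
    refine ⟨by rw [← NNReal.coe_lt_coe]; norm_num, LipschitzWith.of_dist_le_mul fun u v => ?_⟩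
    refine (BoundedContinuousFunction.dist_le (by positivity)).2 fun t => ?_
    have ht : 0 ≤ max t 0 := le_max_right t 0
    have e : Ψ u t - Ψ v t = Real.exp (-(2 * K * max t 0)) •
        ∫ s in (0 : ℝ)..(max t 0), A s *ᵥ w (u - v) s := by
      simp only [Ψ]
      rw [← smul_sub, add_sub_add_left_eq_sub,
        ← intervalIntegral.integral_sub (hint _ (hw u) _ _) (hint _ (hw v) _ _)]
      congr 1
      refine intervalIntegral.integral_congr fun s _ => ?_
      simp only [w]
      rw [← Matrix.mulVec_sub, BoundedContinuousFunction.coe_sub, Pi.sub_apply, smul_sub]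
    change dist (Ψ u t) (Ψ v t) ≤ _
    rw [dist_eq_norm, e, norm_smul, Real.norm_of_nonneg (Real.exp_pos _).le, Real.exp_neg,
      inv_mul_le_iff₀ (Real.exp_pos _), dist_eq_norm]
    have h2 := hbound _ (hw (u - v)) _ (hw_le (u - v)) _ ht
    have h3 := norm_nonneg (u - v)
    push_cast
    nlinarith
  let u := ContractingWith.fixedPoint Φ hΦ
  have hu : Φ u = u := ContractingWith.fixedPoint_isFixedPt hΦ
  refine ⟨w u, hw u, fun t ht => ?_⟩
  have : u t = Ψ u t := by
    conv_lhs => rw [← hu]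
    rfl
  simp only [w]
  rw [this]
  simp only [Ψ, max_eq_left ht]
  rw [smul_smul, ← Real.exp_add, add_neg_cancel, Real.exp_zero, one_smul]

theorem exists_volterra (A : ℝ → Matrix ι ι ℝ)
    (hA : ∀ i j, Measurable fun t => A t i j) {K : ℝ} (hK : 0 < K)
    (hAK : ∀ t, 0 ≤ t → ∀ v : ι → ℝ, ‖A t *ᵥ v‖ ≤ K * ‖v‖)
    {β : ℝ → ι → ℝ} (hβ : ContinuousOn β (Set.Ici 0)) {C : ℝ}
    (hβC : ∀ t, 0 ≤ t → ‖β t‖ ≤ C * Real.exp (2 * K * t)) :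
    ∃ x : ℝ → ι → ℝ, Continuous x ∧ ∀ t, 0 ≤ t →
      IntervalIntegrable (fun s => A s *ᵥ x s) volume 0 t ∧
      x t = β t + ∫ s in (0 : ℝ)..t, A s *ᵥ x s := by
  obtain ⟨x, hx, hxe⟩ := exists_volterra_of_forall_le
    (fun t => if 0 ≤ t then A t else 0)
    (fun i j => by
      have : (fun t => (if 0 ≤ t then A t else 0) i j) = fun t => if 0 ≤ t then A t i j else 0 := by
        ext t; split_ifs <;> rfl
      rw [this]
      exact Measurable.ite measurableSet_Ici (hA i j) measurable_const) hK
    (fun t v => by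
      split_ifs with h
      · exact hAK t h v
      · rw [Matrix.zero_mulVec, norm_zero]; positivity) hβ hβC
  refine ⟨x, hx, fun t ht => ⟨?_, ?_⟩⟩
  · refine IntervalIntegrable.mono_fun' (g := fun s => K * ‖x s‖)
      (Continuous.intervalIntegrable (by fun_prop) _ _) ?_ ?_
    · refine Measurable.aestronglyMeasurable (measurable_pi_lambda _ fun i => ?_)
      simp only [Matrix.mulVec, dotProduct]
      exact Finset.measurable_sum _ fun j _ =>
        (hA i j).mul ((continuous_apply j).comp hx).measurable
    · rw [Set.uIoc_of_le ht]
      filter_upwards [ae_restrict_mem measurableSet_Ioc] with s hs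
      exact hAK s hs.1.le (x s)
  · rw [hxe t ht]
    congr 1
    refine intervalIntegral.integral_congr fun s hs => ?_
    rw [Set.uIcc_of_le ht] at hs
    simp only [if_pos hs.1]

end Volterra

/-! ### Observability over windows -/

section Observability

variable {ι : Type*} [Fintype ι]

theorem Matrix.PosSemidef.quadratic_nonneg {M : Matrix ι ι ℝ} (hM : M.PosSemidef) (v : ι → ℝ) :
    0 ≤ v ⬝ᵥ (M *ᵥ v) := by
  simpa using hM.dotProduct_mulVec_nonneg v

theorem Matrix.IsHermitian.dotProduct_mulVec_comm {M : Matrix ι ι ℝ} (hM : M.IsHermitian)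
    (v w : ι → ℝ) : v ⬝ᵥ (M *ᵥ w) = w ⬝ᵥ (M *ᵥ v) := by
  have h : Mᵀ = M := by ext i j; simpa using hM.apply i j
  rw [Matrix.dotProduct_mulVec, ← Matrix.mulVec_transpose, h, dotProduct_comm]

/-- Young's inequality for the form of M: the defect is 1/σ times the form evaluated at σv - w. -/
theorem Matrix.PosSemidef.quadratic_add_le {M : Matrix ι ι ℝ} (hM : M.PosSemidef) {σ : ℝ}
    (hσ : 0 < σ) (v w : ι → ℝ) :
    (v + w) ⬝ᵥ (M *ᵥ (v + w)) ≤ (1 + σ) * (v ⬝ᵥ (M *ᵥ v)) + (1 + 1 / σ) * (w ⬝ᵥ (M *ᵥ w)) := by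
  have h := hM.quadratic_nonneg (σ • v - w)
  have hc := hM.isHermitian.dotProduct_mulVec_comm v w
  simp only [Matrix.mulVec_sub, Matrix.mulVec_smul, sub_dotProduct, dotProduct_sub,
    smul_dotProduct, dotProduct_smul, smul_eq_mul] at h
  simp only [Matrix.mulVec_add, add_dotProduct, dotProduct_add]
  rw [← sub_nonneg]
  have e : (1 + σ) * (v ⬝ᵥ (M *ᵥ v)) + (1 + 1 / σ) * (w ⬝ᵥ (M *ᵥ w)) -
      (v ⬝ᵥ M *ᵥ v + w ⬝ᵥ M *ᵥ v + (v ⬝ᵥ M *ᵥ w + w ⬝ᵥ M *ᵥ w)) =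
      1 / σ * (σ * (σ * (v ⬝ᵥ (M *ᵥ v))) - σ * (w ⬝ᵥ M *ᵥ v) -
        (σ * (v ⬝ᵥ M *ᵥ w) - w ⬝ᵥ M *ᵥ w)) := by
    field_simp
    ring
  rw [e]
  refine mul_nonneg (by positivity) ?_
  linarith

theorem dotProduct_self_nonneg' (v : ι → ℝ) : 0 ≤ v ⬝ᵥ v :=
  Finset.sum_nonneg fun i _ => mul_self_nonneg (v i)

theorem intervalIntegrable_dotProduct_self {f : ℝ → ι → ℝ} {a b : ℝ}
    (hf2 : ∀ i, IntervalIntegrable (fun s => f s i ^ 2) volume a b) :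
    IntervalIntegrable (fun s => f s ⬝ᵥ f s) volume a b := by
  have : IntervalIntegrable (∑ i, fun s => f s i ^ 2) volume a b :=
    IntervalIntegrable.sum _ fun i _ => hf2 i
  refine this.congr fun s _ => ?_
  simp [dotProduct, sq]

theorem dotProduct_self_integral_le {f : ℝ → ι → ℝ} {v : ι → ℝ} {a b : ℝ} (hab : a ≤ b)
    (hf : ∀ i, IntervalIntegrable (fun s => f s i) volume a b)
    (hf2 : ∀ i, IntervalIntegrable (fun s => f s i ^ 2) volume a b)
    (hv : ∀ i, v i = ∫ s in a..b, f s i) :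
    v ⬝ᵥ v ≤ (b - a) * ∫ s in a..b, f s ⬝ᵥ f s := by
  have e : ∫ s in a..b, f s ⬝ᵥ f s = ∑ i, ∫ s in a..b, f s i ^ 2 := by
    rw [← intervalIntegral.integral_finsetSum fun i _ => hf2 i]
    simp [dotProduct, sq]
  rw [e, Finset.mul_sum]
  refine Finset.sum_le_sum fun i _ => ?_
  rw [hv i, ← sq]
  exact sq_intervalIntegral_le hab (hf i) (hf2 i)

/-- The Gram bound applies to a fixed vector, here the right endpoint x(b). It is split as x(s) plus
the displacement, with Young weight σ. Cauchy-Schwarz bounds the squared displacement by (b -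
s)∫|f|², and integrating b - s produces (b - a)²/2. -/
theorem quadratic_le_window {M : ℝ → Matrix ι ι ℝ} {x f : ℝ → ι → ℝ} {a b l ρ σ : ℝ}
    (hab : a ≤ b) (hσ : 0 < σ) (hρ : 0 ≤ ρ) (hM : ∀ s, (M s).PosSemidef)
    (hMρ : ∀ s ∈ Set.Icc a b, ∀ ξ : ι → ℝ, ξ ⬝ᵥ (M s *ᵥ ξ) ≤ ρ * (ξ ⬝ᵥ ξ))
    (hMi : ∀ ξ : ι → ℝ, IntervalIntegrable (fun s => ξ ⬝ᵥ (M s *ᵥ ξ)) volume a b)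
    (hgram : ∀ ξ : ι → ℝ, l * (ξ ⬝ᵥ ξ) ≤ ∫ s in a..b, ξ ⬝ᵥ (M s *ᵥ ξ))
    (hf : ∀ i, IntervalIntegrable (fun s => f s i) volume a b)
    (hf2 : ∀ i, IntervalIntegrable (fun s => f s i ^ 2) volume a b)
    (hx : ∀ s ∈ Set.Icc a b, ∀ i, x b i - x s i = ∫ r in s..b, f r i)
    (hq : IntervalIntegrable (fun s => x s ⬝ᵥ (M s *ᵥ x s)) volume a b) :
    l * (x b ⬝ᵥ x b) ≤ (1 + σ) * (∫ s in a..b, x s ⬝ᵥ (M s *ᵥ x s)) +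
      (1 + 1 / σ) * ρ * ((b - a) ^ 2 / 2) * ∫ s in a..b, f s ⬝ᵥ f s := by
  set F := ∫ s in a..b, f s ⬝ᵥ f s with hF
  have hff := intervalIntegrable_dotProduct_self hf2
  have hdist : ∀ s ∈ Set.Icc a b, (x b - x s) ⬝ᵥ (x b - x s) ≤ (b - s) * F := by
    intro s hs
    have hsub : Set.uIcc s b ⊆ Set.uIcc a b := by
      rw [Set.uIcc_of_le hs.2, Set.uIcc_of_le hab]
      exact Set.Icc_subset_Icc_left hs.1
    refine (dotProduct_self_integral_le hs.2 (fun i => (hf i).mono_set hsub)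
      (fun i => (hf2 i).mono_set hsub) (fun i => hx s hs i)).trans ?_
    refine mul_le_mul_of_nonneg_left ?_ (sub_nonneg.2 hs.2)
    have h1 : (∫ r in a..s, f r ⬝ᵥ f r) + ∫ r in s..b, f r ⬝ᵥ f r = F := by
      refine intervalIntegral.integral_add_adjacent_intervals (hff.mono_set ?_)
        (hff.mono_set hsub)
      rw [Set.uIcc_of_le hs.1, Set.uIcc_of_le hab]
      exact Set.Icc_subset_Icc_right hs.2
    have h2 : 0 ≤ ∫ r in a..s, f r ⬝ᵥ f r :=
      intervalIntegral.integral_nonneg hs.1 fun r _ => dotProduct_self_nonneg' _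
    linarith
  have hlin : ∫ s in a..b, (b - s) = (b - a) ^ 2 / 2 := by
    rw [intervalIntegral.integral_sub (by simp) (by simp), intervalIntegral.integral_const,
      integral_id, smul_eq_mul]
    ring
  calc l * (x b ⬝ᵥ x b) ≤ ∫ s in a..b, x b ⬝ᵥ (M s *ᵥ x b) := hgram _
    _ ≤ ∫ s in a..b, ((1 + σ) * (x s ⬝ᵥ (M s *ᵥ x s)) +
          (1 + 1 / σ) * ρ * F * (b - s)) := by
        refine intervalIntegral.integral_mono_on hab (hMi _)
          ((hq.const_mul _).add (Continuous.intervalIntegrable (by fun_prop) _ _)) ?_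
        intro s hs
        have h1 := (hM s).quadratic_add_le hσ (x s) (x b - x s)
        rw [add_sub_cancel] at h1
        refine h1.trans (add_le_add_right ?_ _)
        have h2 := hMρ s hs (x b - x s)
        calc (1 + 1 / σ) * ((x b - x s) ⬝ᵥ (M s *ᵥ (x b - x s)))
            ≤ (1 + 1 / σ) * (ρ * ((b - s) * F)) := by
              refine mul_le_mul_of_nonneg_left (h2.trans ?_) (by positivity)
              exact mul_le_mul_of_nonneg_left (hdist s hs) hρ
          _ = _ := by ring
    _ = _ := by
        rw [intervalIntegral.integral_add (hq.const_mul _)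
          (Continuous.intervalIntegrable (by fun_prop) _ _), intervalIntegral.integral_const_mul,
          intervalIntegral.integral_const_mul, hlin]
        ring

/-- Two functions joined at time `0`. -/
noncomputable def splice {E : Type*} (h g : ℝ → E) (s : ℝ) : E := if 0 < s then g s else h s

theorem splice_of_pos {E : Type*} {h g : ℝ → E} {s : ℝ} (hs : 0 < s) : splice h g s = g s :=
  if_pos hs

theorem splice_of_nonpos {E : Type*} {h g : ℝ → E} {s : ℝ} (hs : s ≤ 0) : splice h g s = h s :=
  if_neg hs.not_gt

theorem intervalIntegrable_splice {h g : ℝ → ℝ} {a b : ℝ} (ha : a ≤ 0) (hb : 0 ≤ b)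
    (hh : IntervalIntegrable h volume a 0) (hg : IntervalIntegrable g volume 0 b) :
    IntervalIntegrable (splice h g) volume a b := by
  refine IntervalIntegrable.trans (b := 0) (hh.congr fun s hs => ?_) (hg.congr fun s hs => ?_)
  · rw [Set.uIoc_of_le ha] at hs
    exact (splice_of_nonpos hs.2).symm
  · rw [Set.uIoc_of_le hb] at hs
    exact (splice_of_pos hs.1).symm

theorem integral_splice {h g : ℝ → ℝ} {a b : ℝ} (ha : a ≤ 0) (hb : 0 ≤ b)
    (hh : IntervalIntegrable h volume a 0) (hg : IntervalIntegrable g volume 0 b) :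
    ∫ s in a..b, splice h g s = (∫ s in a..0, h s) + ∫ s in (0 : ℝ)..b, g s := by
  have hi := intervalIntegrable_splice ha hb hh hg
  have hm : (0 : ℝ) ∈ Set.uIcc a b := by rw [Set.uIcc_of_le (ha.trans hb)]; exact ⟨ha, hb⟩
  rw [← intervalIntegral.integral_add_adjacent_intervals
    (hi.mono_set (Set.uIcc_subset_uIcc_left hm)) (hi.mono_set (Set.uIcc_subset_uIcc_right hm))]
  congr 1
  · refine intervalIntegral.integral_congr_ae (Filter.Eventually.of_forall fun s hs => ?_)
    rw [Set.uIoc_of_le ha] at hs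
    exact splice_of_nonpos hs.2
  · refine intervalIntegral.integral_congr_ae (Filter.Eventually.of_forall fun s hs => ?_)
    rw [Set.uIoc_of_le hb] at hs
    exact splice_of_pos hs.1

theorem integral_splice_of_nonneg {h g : ℝ → ℝ} {a b : ℝ} (ha : 0 ≤ a) (hab : a ≤ b) :
    ∫ s in a..b, splice h g s = ∫ s in a..b, g s := by
  refine intervalIntegral.integral_congr_ae (Filter.Eventually.of_forall fun s hs => ?_)
  rw [Set.uIoc_of_le hab] at hs
  exact splice_of_pos (ha.trans_lt hs.1)

/-- The window estimate is integrated over all right endpoints t in [0, τ]. Windows with t < T reach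
before time 0, so the data are extended to [-T, 0] with x frozen at x(0) and f = 0. The price is the
term Tρ|x(0)|². -/
theorem integral_quadratic_le_of_window {M : ℝ → Matrix ι ι ℝ} {x f : ℝ → ι → ℝ}
    {T l ρ σ τ : ℝ} (hT : 0 < T) (hσ : 0 < σ) (hρ : 0 ≤ ρ) (hτ : 0 ≤ τ)
    (hM : ∀ s, (M s).PosSemidef)
    (hMρ : ∀ s, 0 ≤ s → ∀ ξ : ι → ℝ, ξ ⬝ᵥ (M s *ᵥ ξ) ≤ ρ * (ξ ⬝ᵥ ξ))
    (hMi : ∀ (ξ : ι → ℝ) t, 0 ≤ t → IntervalIntegrable (fun s => ξ ⬝ᵥ (M s *ᵥ ξ)) volume 0 t)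
    (hgram : ∀ t, T ≤ t → ∀ ξ : ι → ℝ, l * (ξ ⬝ᵥ ξ) ≤ ∫ s in (t - T)..t, ξ ⬝ᵥ (M s *ᵥ ξ))
    (hf : ∀ i, IntervalIntegrable (fun s => f s i) volume 0 τ)
    (hf2 : ∀ i, IntervalIntegrable (fun s => f s i ^ 2) volume 0 τ)
    (hx : ∀ i, ∀ t ∈ Set.Icc 0 τ, x t i = x 0 i + ∫ s in (0 : ℝ)..t, f s i)
    (hq : IntervalIntegrable (fun s => x s ⬝ᵥ (M s *ᵥ x s)) volume 0 τ) :
    IntervalIntegrable (fun s => x s ⬝ᵥ x s) volume 0 τ ∧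
    l * ∫ s in (0 : ℝ)..τ, x s ⬝ᵥ x s ≤
      (1 + σ) * T * (T * ρ * (x 0 ⬝ᵥ x 0) + ∫ s in (0 : ℝ)..τ, x s ⬝ᵥ (M s *ᵥ x s)) +
      (1 + 1 / σ) * ρ * (T ^ 2 / 2) * T * ∫ s in (0 : ℝ)..τ, f s ⬝ᵥ f s := by
  have hTτ : -T ≤ τ := by linarith
  have hT0 : -T ≤ 0 := by linarith
  have hxx : IntervalIntegrable (fun s => x s ⬝ᵥ x s) volume 0 τ := by
    refine intervalIntegrable_dotProduct_self fun i => ContinuousOn.intervalIntegrable ?_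
    rw [Set.uIcc_of_le hτ]
    exact (continuousOn_of_eq_primitive hτ (hf i) (hx i)).pow 2
  refine ⟨hxx, ?_⟩
  -- With this shift, a window [t - T, t] with 0 ≤ t < T sees M on [t, T] and on [0, t], that is on
  -- all of [0, T], where the Gram bound is available.
  set M' : ℝ → Matrix ι ι ℝ := splice (fun s => M (s + T)) M with hM'
  set x' : ℝ → ι → ℝ := splice (fun _ => x 0) x with hx'
  set f' : ℝ → ι → ℝ := splice (fun _ => 0) f with hf'
  have eM : ∀ ξ : ι → ℝ, (fun s => ξ ⬝ᵥ (M' s *ᵥ ξ)) =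
      splice (fun s => ξ ⬝ᵥ (M (s + T) *ᵥ ξ)) (fun s => ξ ⬝ᵥ (M s *ᵥ ξ)) := by
    intro ξ; ext s; simp only [hM', splice]; split_ifs <;> rfl
  have eq' : (fun s => x' s ⬝ᵥ (M' s *ᵥ x' s)) =
      splice (fun s => x 0 ⬝ᵥ (M (s + T) *ᵥ x 0)) (fun s => x s ⬝ᵥ (M s *ᵥ x s)) := by
    ext s; simp only [hM', hx', splice]; split_ifs <;> rfl
  have ef : ∀ i, (fun s => f' s i) = splice (fun _ => 0) (fun s => f s i) := by
    intro i; ext s; simp only [hf', splice]; split_ifs <;> rfl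
  have ef2 : ∀ i, (fun s => f' s i ^ 2) = splice (fun _ => 0) (fun s => f s i ^ 2) := by
    intro i; ext s; simp only [hf', splice]; split_ifs <;> simp
  have eff : (fun s => f' s ⬝ᵥ f' s) = splice (fun _ => 0) (fun s => f s ⬝ᵥ f s) := by
    ext s; simp only [hf', splice]; split_ifs <;> simp
  have hshift : ∀ ξ : ι → ℝ,
      IntervalIntegrable (fun s => ξ ⬝ᵥ (M (s + T) *ᵥ ξ)) volume (-T) 0 := by
    intro ξ
    have := (hMi ξ T hT.le).comp_add_right T
    simpa using this
  have hMi' : ∀ ξ : ι → ℝ, IntervalIntegrable (fun s => ξ ⬝ᵥ (M' s *ᵥ ξ)) volume (-T) τ := by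
    intro ξ
    rw [eM]
    exact intervalIntegrable_splice hT0 hτ (hshift ξ) (hMi ξ τ hτ)
  have hq' : IntervalIntegrable (fun s => x' s ⬝ᵥ (M' s *ᵥ x' s)) volume (-T) τ := by
    rw [eq']
    exact intervalIntegrable_splice hT0 hτ (hshift _) hq
  have hfi' : ∀ i, IntervalIntegrable (fun s => f' s i) volume (-T) τ := by
    intro i
    rw [ef]
    exact intervalIntegrable_splice hT0 hτ (by simp) (hf i)
  have hfi2' : ∀ i, IntervalIntegrable (fun s => f' s i ^ 2) volume (-T) τ := by
    intro i
    rw [ef2]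
    exact intervalIntegrable_splice hT0 hτ (by simp) (hf2 i)
  have hPSD : ∀ s, (M' s).PosSemidef := by
    intro s; simp only [hM', splice]; split_ifs <;> exact hM _
  have hMρ' : ∀ s, -T ≤ s → ∀ ξ : ι → ℝ, ξ ⬝ᵥ (M' s *ᵥ ξ) ≤ ρ * (ξ ⬝ᵥ ξ) := by
    intro s hs ξ
    simp only [hM', splice]
    split_ifs with h
    · exact hMρ s h.le ξ
    · exact hMρ (s + T) (by linarith) ξ
  have hprim : ∀ i, ∀ s ∈ Set.Icc (-T) τ, x' s i = x 0 i + ∫ r in (-T)..s, f' r i := by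
    intro i s hs
    rcases le_or_gt s 0 with h | h
    · have : ∫ r in (-T)..s, f' r i = 0 := by
        rw [intervalIntegral.integral_congr_ae (g := fun _ => 0)
          (Filter.Eventually.of_forall fun r hr => ?_)]
        · simp
        · rw [Set.uIoc_of_le hs.1] at hr
          simp [hf', splice_of_nonpos (hr.2.trans h)]
      rw [this, hx', splice_of_nonpos h, add_zero]
    · have hsub : IntervalIntegrable (fun s => f s i) volume 0 s := (hf i).mono_set (by
        rw [Set.uIcc_of_le h.le, Set.uIcc_of_le hτ]
        exact Set.Icc_subset_Icc_right hs.2)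
      rw [ef, integral_splice hT0 h.le (by simp) hsub, hx', splice_of_pos h, hx i s ⟨h.le, hs.2⟩]
      simp
  have hwin : ∀ t ∈ Set.Icc 0 τ, l * (x t ⬝ᵥ x t) ≤
      (1 + σ) * (∫ s in (t - T)..t, x' s ⬝ᵥ (M' s *ᵥ x' s)) +
      (1 + 1 / σ) * ρ * (T ^ 2 / 2) * ∫ s in (t - T)..t, f' s ⬝ᵥ f' s := by
    intro t ht
    have htT : t - T ≤ t := by linarith
    have hsub : Set.uIcc (t - T) t ⊆ Set.uIcc (-T) τ := by
      rw [Set.uIcc_of_le htT, Set.uIcc_of_le hTτ]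
      exact Set.Icc_subset_Icc (by linarith [ht.1]) ht.2
    have hgram' : ∀ ξ : ι → ℝ, l * (ξ ⬝ᵥ ξ) ≤ ∫ s in (t - T)..t, ξ ⬝ᵥ (M' s *ᵥ ξ) := by
      intro ξ
      rw [eM]
      rcases le_or_gt T t with h | h
      · rw [integral_splice_of_nonneg (by linarith) htT]
        exact hgram t h ξ
      · have h1 : IntervalIntegrable (fun s => ξ ⬝ᵥ (M (s + T) *ᵥ ξ)) volume (t - T) 0 :=
          (hshift ξ).mono_set (by
            rw [Set.uIcc_of_le (by linarith), Set.uIcc_of_le hT0]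
            exact Set.Icc_subset_Icc_left (by linarith [ht.1]))
        rw [integral_splice (by linarith) ht.1 h1 (hMi ξ t ht.1),
          intervalIntegral.integral_comp_add_right (fun s => ξ ⬝ᵥ (M s *ᵥ ξ)) T, zero_add,
          sub_add_cancel, add_comm, intervalIntegral.integral_add_adjacent_intervals (hMi ξ t ht.1)
            ((hMi ξ T hT.le).mono_set (by
              rw [Set.uIcc_of_le h.le, Set.uIcc_of_le hT.le]
              exact Set.Icc_subset_Icc_left ht.1))]
        have := hgram T le_rfl ξ
        rwa [sub_self] at this
    have hx'' : ∀ s ∈ Set.Icc (t - T) t, ∀ i, x' t i - x' s i = ∫ r in s..t, f' r i := by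
      intro s hs i
      have hsτ : s ∈ Set.Icc (-T) τ := ⟨by linarith [ht.1, hs.1], hs.2.trans ht.2⟩
      have htτ : t ∈ Set.Icc (-T) τ := ⟨by linarith [ht.1], ht.2⟩
      rw [hprim i t htτ, hprim i s hsτ, add_sub_add_left_eq_sub,
        intervalIntegral.integral_interval_sub_left]
      · exact (hfi' i).mono_set (by
          rw [Set.uIcc_of_le htτ.1, Set.uIcc_of_le hTτ]; exact Set.Icc_subset_Icc_right htτ.2)
      · exact (hfi' i).mono_set (by
          rw [Set.uIcc_of_le hsτ.1, Set.uIcc_of_le hTτ]; exact Set.Icc_subset_Icc_right hsτ.2)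
    have key := quadratic_le_window htT hσ hρ hPSD
      (fun s hs => hMρ' s (by linarith [hs.1, ht.1])) (fun ξ => (hMi' ξ).mono_set hsub) hgram'
      (fun i => (hfi' i).mono_set hsub) (fun i => (hfi2' i).mono_set hsub) hx''
      (hq'.mono_set hsub)
    rw [sub_sub_cancel] at key
    have hxt : x' t = x t := by
      rcases ht.1.eq_or_lt with h | h
      · rw [← h, hx', splice_of_nonpos le_rfl]
      · rw [hx', splice_of_pos h]
    rwa [hxt] at key
  obtain ⟨hqi, hqle⟩ := integral_window_le hT.le hτ (fun s => (hPSD s).quadratic_nonneg (x' s)) hq'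
  obtain ⟨hfi, hfle⟩ := integral_window_le hT.le hτ (fun s => dotProduct_self_nonneg' (f' s))
    (intervalIntegrable_dotProduct_self hfi2')
  have hint : l * ∫ s in (0 : ℝ)..τ, x s ⬝ᵥ x s ≤
      (1 + σ) * (∫ t in (0 : ℝ)..τ, ∫ s in (t - T)..t, x' s ⬝ᵥ (M' s *ᵥ x' s)) +
      (1 + 1 / σ) * ρ * (T ^ 2 / 2) * ∫ t in (0 : ℝ)..τ, ∫ s in (t - T)..t, f' s ⬝ᵥ f' s := by
    rw [← intervalIntegral.integral_const_mul, ← intervalIntegral.integral_const_mul,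
      ← intervalIntegral.integral_const_mul,
      ← intervalIntegral.integral_add (hqi.const_mul _) (hfi.const_mul _)]
    exact intervalIntegral.integral_mono_on hτ (hxx.const_mul _)
      ((hqi.const_mul _).add (hfi.const_mul _)) hwin
  have h1 : ∫ s in (-T)..τ, x' s ⬝ᵥ (M' s *ᵥ x' s) ≤
      T * ρ * (x 0 ⬝ᵥ x 0) + ∫ s in (0 : ℝ)..τ, x s ⬝ᵥ (M s *ᵥ x s) := by
    rw [eq', integral_splice hT0 hτ (hshift _) hq]
    refine add_le_add_left ?_ _
    calc ∫ s in (-T)..0, x 0 ⬝ᵥ (M (s + T) *ᵥ x 0)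
        ≤ ∫ s in (-T)..0, ρ * (x 0 ⬝ᵥ x 0) :=
          intervalIntegral.integral_mono_on hT0 (hshift _) (by simp) fun s hs =>
            hMρ (s + T) (by linarith [hs.1]) _
      _ = _ := by
          rw [intervalIntegral.integral_const, smul_eq_mul]; ring
  have h2 : ∫ s in (-T)..τ, f' s ⬝ᵥ f' s = ∫ s in (0 : ℝ)..τ, f s ⬝ᵥ f s := by
    rw [eff, integral_splice hT0 hτ (by simp) (intervalIntegrable_dotProduct_self hf2)]
    simp
  rw [h2] at hfle
  refine hint.trans (add_le_add ?_ ?_)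
  · rw [mul_assoc]
    refine mul_le_mul_of_nonneg_left (hqle.trans ?_) (by linarith)
    exact mul_le_mul_of_nonneg_left h1 hT.le
  · rw [mul_assoc _ T]
    exact mul_le_mul_of_nonneg_left hfle (by positivity)

end Observability

/-! ### Quadratic forms and the spectral norm -/

section QuadraticForms

variable {ι κ : Type*} [Fintype ι] [Fintype κ]

theorem norm_toLp_eq_sqrt (v : ι → ℝ) : ‖WithLp.toLp 2 v‖ = Real.sqrt (v ⬝ᵥ v) := by
  rw [EuclideanSpace.norm_eq]
  simp [dotProduct, sq]

theorem mulVec_dotProduct_self_le [DecidableEq κ] (A : Matrix ι κ ℝ) (v : κ → ℝ) :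
    (A *ᵥ v) ⬝ᵥ (A *ᵥ v) ≤ ‖A‖ ^ 2 * (v ⬝ᵥ v) := by
  have h := A.l2_opNorm_mulVec (WithLp.toLp 2 v)
  have h' : ‖WithLp.toLp 2 (A *ᵥ v)‖ ≤ ‖A‖ * ‖WithLp.toLp 2 v‖ := h
  rw [norm_toLp_eq_sqrt, norm_toLp_eq_sqrt] at h'
  have h2 := mul_self_le_mul_self (Real.sqrt_nonneg _) h'
  rw [Real.mul_self_sqrt (dotProduct_self_nonneg' _)] at h2
  refine h2.trans (le_of_eq ?_)
  have := Real.mul_self_sqrt (dotProduct_self_nonneg' v)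
  linear_combination ‖A‖ ^ 2 * this

theorem dotProduct_sq_le (v w : ι → ℝ) : (v ⬝ᵥ w) ^ 2 ≤ (v ⬝ᵥ v) * (w ⬝ᵥ w) := by
  simpa [dotProduct, sq] using Finset.sum_mul_sq_le_sq_mul_sq Finset.univ v w

theorem abs_dotProduct_mulVec_le [DecidableEq κ] (A : Matrix ι κ ℝ) (v : ι → ℝ) (w : κ → ℝ) :
    |v ⬝ᵥ (A *ᵥ w)| ≤ ‖A‖ * (Real.sqrt (v ⬝ᵥ v) * Real.sqrt (w ⬝ᵥ w)) := by
  refine abs_le_of_sq_le_sq ?_ (by positivity)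
  have h1 := dotProduct_sq_le v (A *ᵥ w)
  have h2 := mulVec_dotProduct_self_le A w
  have h3 := dotProduct_self_nonneg' v
  rw [mul_pow, mul_pow, Real.sq_sqrt h3, Real.sq_sqrt (dotProduct_self_nonneg' w)]
  nlinarith

theorem quadratic_le_norm [DecidableEq ι] (A : Matrix ι ι ℝ) (v : ι → ℝ) :
    v ⬝ᵥ (A *ᵥ v) ≤ ‖A‖ * (v ⬝ᵥ v) := by
  refine (le_abs_self _).trans ((abs_dotProduct_mulVec_le A v v).trans (le_of_eq ?_))
  rw [Real.mul_self_sqrt (dotProduct_self_nonneg' v)]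

theorem abs_entry_le_norm [DecidableEq ι] [DecidableEq κ] (A : Matrix ι κ ℝ) (i : ι) (j : κ) :
    |A i j| ≤ ‖A‖ := by
  simpa [Matrix.mulVec_single_one] using
    abs_dotProduct_mulVec_le A (Pi.single i 1) (Pi.single j 1)

theorem quadratic_eq_sum (A : Matrix ι ι ℝ) (v w : ι → ℝ) :
    v ⬝ᵥ (A *ᵥ w) = ∑ i, ∑ j, A i j * (v i * w j) := by
  simp only [dotProduct, Matrix.mulVec, Finset.mul_sum]
  exact Finset.sum_congr rfl fun i _ => Finset.sum_congr rfl fun j _ => by ring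

theorem quadratic_transpose_mul_self (A : Matrix κ ι ℝ) (v : ι → ℝ) :
    v ⬝ᵥ ((Aᵀ * A) *ᵥ v) = (A *ᵥ v) ⬝ᵥ (A *ᵥ v) := by
  rw [← Matrix.mulVec_mulVec, Matrix.dotProduct_mulVec, Matrix.vecMul_transpose]

theorem posSemidef_transpose_mul_self (A : Matrix κ ι ℝ) : (Aᵀ * A).PosSemidef := by
  simpa using Matrix.posSemidef_conjTranspose_mul_self A

/-- A and Aᵀ have the same norm: for u = Aᵀw, |u|⁴ = (wᵀAu)² ≤ |w|²|Au|² ≤ ρ|w|²|u|². -/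
theorem transpose_mulVec_dotProduct_self_le {A : Matrix κ ι ℝ} {ρ : ℝ} (hρ : 0 ≤ ρ)
    (hA : ∀ v : ι → ℝ, v ⬝ᵥ ((Aᵀ * A) *ᵥ v) ≤ ρ * (v ⬝ᵥ v)) (w : κ → ℝ) :
    (Aᵀ *ᵥ w) ⬝ᵥ (Aᵀ *ᵥ w) ≤ ρ * (w ⬝ᵥ w) := by
  set u := Aᵀ *ᵥ w with hu
  have h1 : u ⬝ᵥ u = w ⬝ᵥ (A *ᵥ u) := by
    rw [Matrix.dotProduct_mulVec, ← Matrix.mulVec_transpose, Matrix.transpose_transpose,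
      dotProduct_comm]
  have h2 := dotProduct_sq_le w (A *ᵥ u)
  have h3 := hA u
  rw [quadratic_transpose_mul_self] at h3
  have h4 := dotProduct_self_nonneg' u
  have h5 := dotProduct_self_nonneg' w
  rw [← h1] at h2
  rcases h4.eq_or_lt with h | h
  · rw [← h]; positivity
  · have : (u ⬝ᵥ u) * (u ⬝ᵥ u) ≤ (ρ * (w ⬝ᵥ w)) * (u ⬝ᵥ u) := by nlinarith
    exact le_of_mul_le_mul_right this h

/-- An eigenvector with nonzero eigenvalue is orthogonal to the kernel vector u. So u is a multiple
of the basis vector of index i₀, and y has no component along it. -/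
theorem quadratic_ge_of_eigenvalues [DecidableEq ι] {A : Matrix ι ι ℝ} (hA : A.IsHermitian)
    {lam : ℝ} {i₀ : ι} (hpos : 0 < lam)
    (hlam : ∀ j, j ≠ i₀ → lam ≤ hA.eigenvalues j) {u : ι → ℝ} (hu : u ≠ 0) (hAu : A *ᵥ u = 0)
    {y : ι → ℝ} (hy : u ⬝ᵥ y = 0) : lam * (y ⬝ᵥ y) ≤ y ⬝ᵥ (A *ᵥ y) := by
  set b := hA.eigenvectorBasis with hb
  have hsymm : ∀ (v : ι → ℝ) j, (b j).ofLp ⬝ᵥ (A *ᵥ v) = hA.eigenvalues j * ((b j).ofLp ⬝ᵥ v) := by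
    intro v j
    rw [hA.dotProduct_mulVec_comm, hA.mulVec_eigenvectorBasis, dotProduct_smul, smul_eq_mul,
      dotProduct_comm]
  have hsum : ∀ v w : ι → ℝ, v ⬝ᵥ w = ∑ j, ((b j).ofLp ⬝ᵥ v) * ((b j).ofLp ⬝ᵥ w) := by
    intro v w
    have h := b.sum_inner_mul_inner (WithLp.toLp 2 v) (WithLp.toLp 2 w)
    simp only [EuclideanSpace.inner_eq_star_dotProduct, star_trivial] at h
    rw [dotProduct_comm, ← h]
    refine Finset.sum_congr rfl fun j _ => ?_
    rw [dotProduct_comm w]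
  have hperp : ∀ j, j ≠ i₀ → (b j).ofLp ⬝ᵥ u = 0 := by
    intro j hj
    have h := hsymm u j
    rw [hAu, dotProduct_zero] at h
    exact (mul_eq_zero.1 h.symm).resolve_left (hpos.trans_le (hlam j hj)).ne'
  have hone : ∀ v : ι → ℝ, u ⬝ᵥ v = ((b i₀).ofLp ⬝ᵥ u) * ((b i₀).ofLp ⬝ᵥ v) := by
    intro v
    rw [hsum, Finset.sum_eq_single i₀]
    · intro j _ hj
      rw [hperp j hj, zero_mul]
    · simp
  have hne : (b i₀).ofLp ⬝ᵥ u ≠ 0 := by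
    intro h
    have := hone u
    rw [h, zero_mul] at this
    exact hu (dotProduct_self_eq_zero.1 this)
  have hy0 : (b i₀).ofLp ⬝ᵥ y = 0 := by
    have := hone y
    rw [hy] at this
    exact (mul_eq_zero.1 this.symm).resolve_left hne
  rw [hsum y y, hsum y (A *ᵥ y), Finset.mul_sum]
  refine Finset.sum_le_sum fun j _ => ?_
  rw [hsymm]
  by_cases hj : j = i₀
  · rw [hj, hy0]; simp
  · nlinarith [hlam j hj, mul_self_nonneg ((b j).ofLp ⬝ᵥ y)]

end QuadraticForms

/-! ### The Laplacian and the output matrix -/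

theorem EdgeOrientation.src_ne_snk {n : ℕ} {G : SimpleGraph (Fin n)} (o : EdgeOrientation G)
    (e : G.edgeSet) : o.src e ≠ o.snk e := by
  have h : s(o.src e, o.snk e) ∈ G.edgeSet := by rw [o.ends e]; exact e.2
  exact (G.mem_edgeSet.1 h).ne

theorem EdgeOrientation.sum_incidence {n : ℕ} {G : SimpleGraph (Fin n)} (o : EdgeOrientation G)
    (e : G.edgeSet) : ∑ i, o.incidence i e = 0 := by
  have h : ∀ i, o.incidence i e =
      (if i = o.src e then 1 else 0) - (if i = o.snk e then (1 : ℝ) else 0) := by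
    intro i
    have := o.src_ne_snk e
    simp only [incidence, Matrix.of_apply]
    split_ifs <;> simp_all
  simp [h]

open Classical in
theorem EdgeOrientation.incidence_mul_incidence {n : ℕ} {G : SimpleGraph (Fin n)}
    (o : EdgeOrientation G) {i j : Fin n} (hij : i ≠ j) (e : G.edgeSet) :
    o.incidence i e * o.incidence j e = if (e : Sym2 (Fin n)) = s(i, j) then -1 else 0 := by
  have hne := o.src_ne_snk e
  rw [← o.ends e]
  simp only [incidence, Matrix.of_apply, Sym2.eq_iff]
  by_cases h1 : i = o.src e <;> by_cases h2 : j = o.snk e <;> by_cases h3 : i = o.snk e <;>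
    by_cases h4 : j = o.src e <;> simp_all [eq_comm]

namespace SensorNetwork

variable {n N Ny : ℕ} (S : SensorNetwork n N Ny)

open Classical in
theorem laplacian_apply_of_ne (t : ℝ) {i j : Fin n} (hij : i ≠ j) :
    S.laplacian t i j = if (S.graph t).Adj i j then -1 else 0 := by
  simp only [laplacian, incidence, Matrix.mul_apply, Matrix.transpose_apply,
    (S.orient t).incidence_mul_incidence hij]
  split_ifs with h
  · rw [Finset.sum_eq_single (⟨s(i, j), h⟩ : (S.graph t).edgeSet)]
    · simp
    · intro e _ he
      rw [if_neg fun h' => he (Subtype.ext h')]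
    · simp
  · refine Finset.sum_eq_zero fun e _ => if_neg fun h' => h ?_
    have := e.2
    rw [h'] at this
    exact this

theorem sum_laplacian (t : ℝ) (i : Fin n) : ∑ j, S.laplacian t i j = 0 := by
  simp only [laplacian, Matrix.mul_apply, Matrix.transpose_apply]
  rw [Finset.sum_comm]
  refine Finset.sum_eq_zero fun e _ => ?_
  rw [← Finset.mul_sum, incidence, EdgeOrientation.sum_incidence, mul_zero]

/-- The orientation may vary non-measurably in time, but it cancels in D Dᵀ: off-diagonal entries
depend only on adjacency, and zero row sums give the diagonal. -/
theorem measurable_laplacian (i j : Fin n) : Measurable fun t => S.laplacian t i j := by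
  classical
  have hne : ∀ {i j : Fin n}, i ≠ j → Measurable fun t => S.laplacian t i j := by
    intro i j hij
    simp only [S.laplacian_apply_of_ne _ hij]
    exact Measurable.ite (S.measurable_graph i j) measurable_const measurable_const
  by_cases hij : i = j
  · subst hij
    have : ∀ t, S.laplacian t i i = -∑ j ∈ Finset.univ.erase i, S.laplacian t i j := by
      intro t
      have := S.sum_laplacian t i
      rw [← Finset.add_sum_erase _ _ (Finset.mem_univ i)] at this
      linarith
    simp only [this]
    exact (Finset.measurable_sum _ fun j hj => hne (Finset.ne_of_mem_erase hj).symm).neg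
  · exact hne hij

/-- `Λ̄(t)ᵀ Λ̄(t)`. -/
noncomputable def outputGram (α t : ℝ) : Matrix (Fin n × Fin N) (Fin n × Fin N) ℝ :=
  (S.Lambda α t)ᵀ * S.Lambda α t

theorem outputGram_apply {α : ℝ} (hα : 0 ≤ α) (t : ℝ) (a b : Fin n × Fin N) :
    S.outputGram α t a b =
      (if a.1 = b.1 then ((S.C a.1 t)ᵀ * S.C a.1 t) a.2 b.2 else 0) +
        α * (S.laplacian t a.1 b.1 * if a.2 = b.2 then 1 else 0) := by
  have hs : ((Real.sqrt α • ((S.incidence t)ᵀ ⊗ₖ (1 : Matrix (Fin N) (Fin N) ℝ)))ᵀ *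
      (Real.sqrt α • ((S.incidence t)ᵀ ⊗ₖ (1 : Matrix (Fin N) (Fin N) ℝ)))) =
      α • (S.laplacian t ⊗ₖ (1 : Matrix (Fin N) (Fin N) ℝ)) := by
    rw [Matrix.transpose_smul, Matrix.smul_mul, Matrix.mul_smul, smul_smul,
      Real.mul_self_sqrt hα, ← Matrix.kroneckerMap_transpose, ← Matrix.mul_kronecker_mul]
    simp [laplacian]
  have hc : ((S.Cbar t)ᵀ * S.Cbar t) a b =
      if a.1 = b.1 then ((S.C a.1 t)ᵀ * S.C a.1 t) a.2 b.2 else 0 := by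
    simp only [Matrix.mul_apply, Matrix.transpose_apply, Cbar, Matrix.of_apply,
      Fintype.sum_prod_type]
    rw [Finset.sum_eq_single a.1]
    · by_cases h : a.1 = b.1 <;> simp [h]
    · intro i _ hi
      simp [hi]
    · simp
  rw [outputGram, Lambda, Matrix.transpose_fromRows, Matrix.fromCols_mul_fromRows, hs,
    Matrix.add_apply, hc, Matrix.smul_apply, Matrix.kroneckerMap_apply, Matrix.one_apply,
    smul_eq_mul]

theorem measurable_outputGram {α : ℝ} (hα : 0 ≤ α) (a b : Fin n × Fin N) :
    Measurable fun t => S.outputGram α t a b := by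
  simp only [S.outputGram_apply hα]
  refine Measurable.add ?_ (((S.measurable_laplacian _ _).mul measurable_const).const_mul α)
  split_ifs
  · simp only [Matrix.mul_apply, Matrix.transpose_apply]
    exact Finset.measurable_sum _ fun k _ => (S.measurable_C _ _ _).mul (S.measurable_C _ _ _)
  · exact measurable_const

theorem posSemidef_outputGram (α t : ℝ) : (S.outputGram α t).PosSemidef :=
  posSemidef_transpose_mul_self _

theorem outputGram_quadratic {α : ℝ} (hα : 0 ≤ α) (t : ℝ) (ξ : Fin n × Fin N → ℝ) :
    ξ ⬝ᵥ (S.outputGram α t *ᵥ ξ) =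
      (∑ i, (fun k => ξ (i, k)) ⬝ᵥ (((S.C i t)ᵀ * S.C i t) *ᵥ fun k => ξ (i, k))) +
        α * ∑ k, (fun i => ξ (i, k)) ⬝ᵥ (S.laplacian t *ᵥ fun i => ξ (i, k)) := by
  simp only [quadratic_eq_sum, S.outputGram_apply hα, Fintype.sum_prod_type, add_mul,
    Finset.sum_add_distrib, Finset.mul_sum]
  congr 1
  · refine Finset.sum_congr rfl fun i _ => Finset.sum_congr rfl fun k _ => ?_
    rw [Finset.sum_eq_single i]
    · simp
    · intro j _ hj
      simp [hj.symm]
    · simp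
  · rw [Finset.sum_comm]
    refine Finset.sum_congr rfl fun k _ => Finset.sum_congr rfl fun i _ =>
      Finset.sum_congr rfl fun j _ => ?_
    rw [Finset.sum_eq_single k]
    · simp; ring
    · intro l _ hl
      simp [hl.symm]
    · simp

end SensorNetwork

/-! ### Excitation of the output matrix over a window -/

theorem iota2lo_nonneg {n N : ℕ} {T ι₁lo r₂ lam α : ℝ} (hα : 0 ≤ α) (hlam : 0 ≤ lam) :
    0 ≤ iota2lo n N T ι₁lo r₂ lam α := by
  refine Real.sInf_nonneg ?_
  rintro _ ⟨a, ha, rfl⟩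
  exact le_max_of_le_left (mul_nonneg (mul_nonneg hα hlam) (sub_nonneg.2 ha))

theorem iota2lo_le {n N : ℕ} (hN : 0 < N) {T ι₁lo r₂ lam α θ : ℝ} (hα : 0 ≤ α) (hlam : 0 ≤ lam)
    (hθ0 : 0 ≤ θ) (hθ1 : θ ≤ 1) :
    iota2lo n N T ι₁lo r₂ lam α ≤ max (α * lam * (1 - θ))
      (ι₁lo / n * θ - 2 * r₂ * T * Real.sqrt (θ * (1 - θ))) := by
  -- The objective depends only on |a|², so any vector of squared length θ will do. The first branch
  -- of the maximum bounds it below by 0.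
  refine csInf_le ⟨0, ?_⟩ ⟨EuclideanSpace.single ⟨0, hN⟩ (Real.sqrt θ), ?_, ?_⟩
  · rintro _ ⟨a, ha, rfl⟩
    exact le_max_of_le_left (mul_nonneg (mul_nonneg hα hlam) (sub_nonneg.2 ha))
  · simpa [abs_of_nonneg (Real.sqrt_nonneg θ)] using hθ1
  · simp [Real.sq_sqrt hθ0]

/-- Homogeneous form of the minimum. Here θ = nA/(nA + B) is the share of squared length carried by
the average, when A and B are the squared lengths of the average and of the deviation. -/
theorem iota2lo_mul_le {n N : ℕ} (hn : 0 < n) (hN : 0 < N) {T ι₁lo r₂ lam α A B : ℝ}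
    (hα : 0 ≤ α) (hlam : 0 ≤ lam) (hA : 0 ≤ A) (hB : 0 ≤ B) :
    iota2lo n N T ι₁lo r₂ lam α * (n * A + B) ≤
      max (α * lam * B) (ι₁lo * A - 2 * r₂ * T * Real.sqrt (n * A * B)) := by
  have hn' : (0 : ℝ) < n := by exact_mod_cast hn
  have hS : 0 ≤ n * A + B := by positivity
  rcases hS.eq_or_lt with h | h
  · rw [← h, mul_zero]
    have hB0 : B = 0 := by nlinarith [mul_nonneg hn'.le hA]
    refine le_max_of_le_left ?_
    rw [hB0, mul_zero]
  set s := n * A + B with hs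
  have hθ : n * A / s ≤ 1 := by
    rw [div_le_one h]; linarith
  have h1 : 1 - n * A / s = B / s := by
    rw [eq_div_iff h.ne', sub_mul, div_mul_cancel₀ _ h.ne']; linarith
  have key := mul_le_mul_of_nonneg_right
    (iota2lo_le (n := n) (T := T) (ι₁lo := ι₁lo) (r₂ := r₂) hN hα hlam
      (by positivity : 0 ≤ n * A / s) hθ) hS
  refine key.trans (le_of_eq ?_)
  rw [max_mul_of_nonneg _ _ hS, h1]
  have h2 : n * A / s * (B / s) = (n * A * B) / s ^ 2 := by field_simp
  rw [h2, Real.sqrt_div (by positivity), Real.sqrt_sq hS]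
  congr 1
  · field_simp
  · field_simp

/-! ### Splitting a vector into its average over the sensors and the deviation from it. -/

section Decomposition

variable {n N : ℕ}

/-- The average over the first index. -/
noncomputable def blockMean (ξ : Fin n × Fin N → ℝ) (k : Fin N) : ℝ := (∑ i, ξ (i, k)) / n

/-- The deviation from the average over the first index. -/
noncomputable def blockDev (ξ : Fin n × Fin N → ℝ) (a : Fin n × Fin N) : ℝ := ξ a - blockMean ξ a.2

theorem sum_blockDev (hn : 0 < n) (ξ : Fin n × Fin N → ℝ) (k : Fin N) :
    ∑ i, blockDev ξ (i, k) = 0 := by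
  have hn' : (n : ℝ) ≠ 0 := by exact_mod_cast hn.ne'
  simp only [blockDev, blockMean, Finset.sum_sub_distrib, Finset.sum_const, Finset.card_univ,
    Fintype.card_fin, nsmul_eq_mul]
  field_simp
  ring

theorem dotProduct_self_eq_blockMean_add (hn : 0 < n) (ξ : Fin n × Fin N → ℝ) :
    ξ ⬝ᵥ ξ = n * (blockMean ξ ⬝ᵥ blockMean ξ) + blockDev ξ ⬝ᵥ blockDev ξ := by
  have h : ∀ i k, ξ (i, k) * ξ (i, k) = blockMean ξ k * blockMean ξ k +
      2 * blockMean ξ k * blockDev ξ (i, k) + blockDev ξ (i, k) * blockDev ξ (i, k) := by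
    intro i k; simp only [blockDev]; ring
  simp only [dotProduct, Fintype.sum_prod_type, h, Finset.sum_add_distrib]
  have h2 : ∑ i : Fin n, ∑ k : Fin N, 2 * blockMean ξ k * blockDev ξ (i, k) = 0 := by
    rw [Finset.sum_comm]
    refine Finset.sum_eq_zero fun k _ => ?_
    rw [← Finset.mul_sum, sum_blockDev hn, mul_zero]
  rw [h2]
  simp

theorem dotProduct_self_eq_sum_fst (v : Fin n × Fin N → ℝ) :
    v ⬝ᵥ v = ∑ i, (fun k => v (i, k)) ⬝ᵥ (fun k => v (i, k)) := by
  simp only [dotProduct, Fintype.sum_prod_type]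

theorem dotProduct_self_eq_sum_snd (v : Fin n × Fin N → ℝ) :
    v ⬝ᵥ v = ∑ k, (fun i => v (i, k)) ⬝ᵥ (fun i => v (i, k)) := by
  simp only [dotProduct, Fintype.sum_prod_type]
  exact Finset.sum_comm

end Decomposition

theorem intervalIntegral_quadratic {ι : Type*} [Fintype ι] {A : ℝ → Matrix ι ι ℝ} {a b : ℝ}
    (hA : ∀ i j, IntervalIntegrable (fun s => A s i j) volume a b) (v w : ι → ℝ) :
    IntervalIntegrable (fun s => v ⬝ᵥ (A s *ᵥ w)) volume a b ∧
    ∫ s in a..b, v ⬝ᵥ (A s *ᵥ w) =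
      v ⬝ᵥ ((Matrix.of fun i j => ∫ s in a..b, A s i j) *ᵥ w) := by
  simp only [quadratic_eq_sum]
  have h1 : ∀ i, IntervalIntegrable (fun s => ∑ j, A s i j * (v i * w j)) volume a b := by
    intro i
    have : IntervalIntegrable (∑ j, fun s => A s i j * (v i * w j)) volume a b :=
      IntervalIntegrable.sum _ fun j _ => (hA i j).mul_const _
    refine this.congr fun s _ => ?_
    simp
  constructor
  · have : IntervalIntegrable (∑ i, fun s => ∑ j, A s i j * (v i * w j)) volume a b :=
      IntervalIntegrable.sum _ fun i _ => h1 i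
    refine this.congr fun s _ => ?_
    simp
  · rw [intervalIntegral.integral_finsetSum fun i _ => h1 i]
    refine Finset.sum_congr rfl fun i _ => ?_
    rw [intervalIntegral.integral_finsetSum fun j _ => (hA i j).mul_const _]
    refine Finset.sum_congr rfl fun j _ => ?_
    rw [intervalIntegral.integral_mul_const, Matrix.of_apply]

theorem intervalIntegrable_of_abs_le {f : ℝ → ℝ} {a b R : ℝ} (hf : Measurable f) (ha : 0 ≤ a)
    (hb : 0 ≤ b) (hR : ∀ s, 0 ≤ s → |f s| ≤ R) : IntervalIntegrable f volume a b := by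
  refine IntervalIntegrable.mono_fun' (g := fun _ => R) (by simp) hf.aestronglyMeasurable ?_
  filter_upwards [ae_restrict_mem measurableSet_uIoc] with s hs
  exact hR s ((le_min ha hb).trans hs.1.le)

/-! ### Bounds on the Gram matrix of the output, pointwise and over a window. -/

namespace SensorNetwork

variable {n N Ny : ℕ} {S : SensorNetwork n N Ny} {T ι₁lo ι₁hi r₂ r₃ lam : ℝ}

theorem Excited.outputGram_le (hS : S.Excited T ι₁lo ι₁hi r₂ r₃ lam) {α : ℝ} (hα : 0 ≤ α) {t : ℝ}
    (ht : 0 ≤ t) (ξ : Fin n × Fin N → ℝ) :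
    ξ ⬝ᵥ (S.outputGram α t *ᵥ ξ) ≤ (r₂ + α * r₃) * (ξ ⬝ᵥ ξ) := by
  rw [outputGram_quadratic S hα, add_mul, mul_assoc]
  refine add_le_add ?_ (mul_le_mul_of_nonneg_left ?_ hα)
  · rw [dotProduct_self_eq_sum_fst, Finset.mul_sum]
    refine Finset.sum_le_sum fun i _ => ?_
    refine (quadratic_le_norm _ _).trans ?_
    exact mul_le_mul_of_nonneg_right (hS.regressor_le t ht i) (dotProduct_self_nonneg' _)
  · rw [dotProduct_self_eq_sum_snd, Finset.mul_sum]
    refine Finset.sum_le_sum fun k _ => ?_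
    refine (quadratic_le_norm _ _).trans ?_
    exact mul_le_mul_of_nonneg_right (hS.laplacian_le t ht) (dotProduct_self_nonneg' _)

theorem Excited.intervalIntegrable_laplacian (hS : S.Excited T ι₁lo ι₁hi r₂ r₃ lam) {a b : ℝ}
    (ha : 0 ≤ a) (hb : 0 ≤ b) (i j : Fin n) :
    IntervalIntegrable (fun s => S.laplacian s i j) volume a b :=
  intervalIntegrable_of_abs_le (S.measurable_laplacian i j) ha hb fun s hs =>
    (abs_entry_le_norm _ i j).trans (hS.laplacian_le s hs)

theorem Excited.intervalIntegrable_regressor (hS : S.Excited T ι₁lo ι₁hi r₂ r₃ lam) {a b : ℝ}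
    (ha : 0 ≤ a) (hb : 0 ≤ b) (i : Fin n) (k l : Fin N) :
    IntervalIntegrable (fun s => ((S.C i s)ᵀ * S.C i s) k l) volume a b := by
  refine intervalIntegrable_of_abs_le ?_ ha hb fun s hs =>
    (abs_entry_le_norm _ k l).trans (hS.regressor_le s hs i)
  simp only [Matrix.mul_apply, Matrix.transpose_apply]
  exact Finset.measurable_sum _ fun m _ => (S.measurable_C _ _ _).mul (S.measurable_C _ _ _)

/-- Constant vectors lie in the kernel of every L(s), hence of the integral. So c drops out, and the
spectral gap applies to y, which is orthogonal to them. -/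
theorem Excited.laplacian_window (hS : S.Excited T ι₁lo ι₁hi r₂ r₃ lam) (hn : 0 < n) {t : ℝ}
    (ht : T ≤ t) {y : Fin n → ℝ} (hy : ∑ i, y i = 0) (c : ℝ) :
    lam * (y ⬝ᵥ y) ≤
      ∫ s in (t - T)..t, (fun i => c + y i) ⬝ᵥ (S.laplacian s *ᵥ fun i => c + y i) := by
  have ha : 0 ≤ t - T := sub_nonneg.2 ht
  have hb : 0 ≤ t := hS.T_pos.le.trans ht
  rw [(intervalIntegral_quadratic
    (fun i j => hS.intervalIntegrable_laplacian ha hb i j) _ _).2]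
  change _ ≤ _ ⬝ᵥ (S.intLaplacian T t *ᵥ _)
  set A := S.intLaplacian T t with hA
  have hAh : A.IsHermitian := S.isHermitian_intLaplacian T t
  obtain ⟨i₀, -, hlam⟩ := hS.connected t ht
  have hA1 : A *ᵥ (fun _ => 1) = 0 := by
    ext i
    simp only [Matrix.mulVec, dotProduct, mul_one, Pi.zero_apply, hA, intLaplacian,
      Matrix.of_apply]
    rw [← intervalIntegral.integral_finsetSum
      fun j _ => hS.intervalIntegrable_laplacian ha hb i j]
    simp [sum_laplacian]
  have hu : (fun _ : Fin n => (1 : ℝ)) ≠ 0 := fun h => one_ne_zero (congr_fun h ⟨0, hn⟩)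
  have key := quadratic_ge_of_eigenvalues hAh hS.lam_pos hlam hu hA1 (y := y)
    (by simpa [dotProduct] using hy)
  have e : (fun i => c + y i) = c • (fun _ : Fin n => (1 : ℝ)) + y := by
    ext i; simp
  rw [e, Matrix.mulVec_add, Matrix.mulVec_smul, hA1, smul_zero, zero_add, add_dotProduct,
    smul_dotProduct, hAh.dotProduct_mulVec_comm, hA1, dotProduct_zero, smul_zero, zero_add]
  exact key

theorem Excited.regressor_window (hS : S.Excited T ι₁lo ι₁hi r₂ r₃ lam) {t : ℝ}
    (ht : T ≤ t) (v : Fin N → ℝ) :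
    ι₁lo * (v ⬝ᵥ v) ≤ ∫ s in (t - T)..t, ∑ i, v ⬝ᵥ (((S.C i s)ᵀ * S.C i s) *ᵥ v) := by
  have ha : 0 ≤ t - T := sub_nonneg.2 ht
  have hb : 0 ≤ t := hS.T_pos.le.trans ht
  have h := (hS.excitation_lower t ht).quadratic_nonneg v
  rw [Matrix.sub_mulVec, dotProduct_sub, Matrix.smul_mulVec, Matrix.one_mulVec, dotProduct_smul,
    smul_eq_mul, sub_nonneg] at h
  refine h.trans (le_of_eq ?_)
  have hi : ∀ k l, IntervalIntegrable
      (fun s => (∑ i, (S.C i s)ᵀ * S.C i s) k l) volume (t - T) t := by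
    intro k l
    have : IntervalIntegrable (∑ i, fun s => ((S.C i s)ᵀ * S.C i s) k l) volume (t - T) t :=
      IntervalIntegrable.sum _ fun i _ => hS.intervalIntegrable_regressor ha hb i k l
    refine this.congr fun s _ => ?_
    simp [Matrix.sum_apply]
  have := (intervalIntegral_quadratic hi v v).2
  rw [show S.intRegressor T t = Matrix.of fun a b =>
    ∫ s in (t - T)..t, (∑ i, (S.C i s)ᵀ * S.C i s) a b from rfl, ← this]
  simp [Matrix.sum_mulVec, dotProduct_sum]

/-- The terms quadratic in w are nonnegative and are dropped. The cross terms are bounded by the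
spectral norm and then by Cauchy-Schwarz over the n sensors, which produces the factor n under the
root. -/
theorem Excited.regressor_cross (hS : S.Excited T ι₁lo ι₁hi r₂ r₃ lam) {s : ℝ} (hs : 0 ≤ s)
    (v : Fin N → ℝ) (w : Fin n → Fin N → ℝ) :
    (∑ i, v ⬝ᵥ (((S.C i s)ᵀ * S.C i s) *ᵥ v)) -
      2 * r₂ * Real.sqrt (n * (v ⬝ᵥ v) * ∑ i, w i ⬝ᵥ w i) ≤
      ∑ i, (v + w i) ⬝ᵥ (((S.C i s)ᵀ * S.C i s) *ᵥ (v + w i)) := by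
  have h1 : ∑ i, -(r₂ * (Real.sqrt (v ⬝ᵥ v) * Real.sqrt (w i ⬝ᵥ w i))) ≤
      ∑ i, v ⬝ᵥ (((S.C i s)ᵀ * S.C i s) *ᵥ w i) := by
    refine Finset.sum_le_sum fun i _ => ?_
    refine neg_le_of_abs_le ((abs_dotProduct_mulVec_le _ v (w i)).trans ?_)
    exact mul_le_mul_of_nonneg_right (hS.regressor_le s hs i) (by positivity)
  have h2 : ∑ i, Real.sqrt (v ⬝ᵥ v) * Real.sqrt (w i ⬝ᵥ w i) ≤
      Real.sqrt (n * (v ⬝ᵥ v) * ∑ i, w i ⬝ᵥ w i) := by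
    refine (Real.sum_sqrt_mul_sqrt_le Finset.univ (f := fun _ => v ⬝ᵥ v)
      (fun _ => dotProduct_self_nonneg' v) (fun i => dotProduct_self_nonneg' (w i))).trans
      (le_of_eq ?_)
    rw [← Real.sqrt_mul (Finset.sum_nonneg fun _ _ => dotProduct_self_nonneg' v)]
    simp
  rw [Finset.sum_neg_distrib, ← Finset.mul_sum] at h1
  have h3 := mul_le_mul_of_nonneg_left h2 hS.r₂_pos.le
  have h4 : ∀ i, (v + w i) ⬝ᵥ (((S.C i s)ᵀ * S.C i s) *ᵥ (v + w i)) =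
      v ⬝ᵥ (((S.C i s)ᵀ * S.C i s) *ᵥ v) + 2 * (v ⬝ᵥ (((S.C i s)ᵀ * S.C i s) *ᵥ w i)) +
        w i ⬝ᵥ (((S.C i s)ᵀ * S.C i s) *ᵥ w i) := by
    intro i
    have := (posSemidef_transpose_mul_self (S.C i s)).isHermitian.dotProduct_mulVec_comm v (w i)
    rw [Matrix.mulVec_add, add_dotProduct, dotProduct_add, dotProduct_add, ← this]
    ring
  have h5 : 0 ≤ ∑ i, w i ⬝ᵥ (((S.C i s)ᵀ * S.C i s) *ᵥ w i) :=
    Finset.sum_nonneg fun i _ => (posSemidef_transpose_mul_self (S.C i s)).quadratic_nonneg _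
  simp only [h4, Finset.sum_add_distrib, ← Finset.mul_sum]
  linarith

theorem Excited.intervalIntegrable_outputGram (hS : S.Excited T ι₁lo ι₁hi r₂ r₃ lam) {α : ℝ}
    (hα : 0 ≤ α) {a b : ℝ} (ha : 0 ≤ a) (hb : 0 ≤ b) (ξ : Fin n × Fin N → ℝ) :
    IntervalIntegrable (fun s => ξ ⬝ᵥ (S.outputGram α s *ᵥ ξ)) volume a b := by
  refine intervalIntegrable_of_abs_le ?_ ha hb (R := (r₂ + α * r₃) * (ξ ⬝ᵥ ξ)) fun s hs => ?_
  · simp only [quadratic_eq_sum]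
    exact Finset.measurable_sum _ fun i _ => Finset.measurable_sum _ fun j _ =>
      (S.measurable_outputGram hα i j).mul_const _
  · rw [abs_of_nonneg ((S.posSemidef_outputGram α s).quadratic_nonneg ξ)]
    exact hS.outputGram_le hα hs ξ

/-- The integral is the sum of a regressor part and a Laplacian part, both nonnegative. The
Laplacian part sees only the deviation; the regressor part sees the average, up to a cross term. The
sum dominates either lower bound, hence their maximum, which is where the max in ι₂lo comes from. -/
theorem Excited.outputGram_window (hS : S.Excited T ι₁lo ι₁hi r₂ r₃ lam) (hn : 0 < n) (hN : 0 < N)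
    {α : ℝ} (hα : 0 ≤ α) {t : ℝ} (ht : T ≤ t) (ξ : Fin n × Fin N → ℝ) :
    iota2lo n N T ι₁lo r₂ lam α * (ξ ⬝ᵥ ξ) ≤
      ∫ s in (t - T)..t, ξ ⬝ᵥ (S.outputGram α s *ᵥ ξ) := by
  have ha : 0 ≤ t - T := sub_nonneg.2 ht
  have hb : 0 ≤ t := hS.T_pos.le.trans ht
  have hab : t - T ≤ t := by linarith [hS.T_pos]
  have hCi : ∀ (v : Fin n → Fin N → ℝ), IntervalIntegrable
      (fun s => ∑ i, v i ⬝ᵥ (((S.C i s)ᵀ * S.C i s) *ᵥ v i)) volume (t - T) t := by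
    intro v
    have : IntervalIntegrable (∑ i, fun s => v i ⬝ᵥ (((S.C i s)ᵀ * S.C i s) *ᵥ v i))
        volume (t - T) t := IntervalIntegrable.sum _ fun i _ =>
      (intervalIntegral_quadratic (fun k l => hS.intervalIntegrable_regressor ha hb i k l) _ _).1
    refine this.congr fun s _ => ?_
    simp
  have hL1 : ∀ y : Fin n → ℝ, IntervalIntegrable (fun s => y ⬝ᵥ (S.laplacian s *ᵥ y))
      volume (t - T) t := fun y =>
    (intervalIntegral_quadratic (fun k l => hS.intervalIntegrable_laplacian ha hb k l) _ _).1
  have hLi : IntervalIntegrable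
      (fun s => ∑ k, (fun i => ξ (i, k)) ⬝ᵥ (S.laplacian s *ᵥ fun i => ξ (i, k)))
      volume (t - T) t := by
    have : IntervalIntegrable
        (∑ k, fun s => (fun i => ξ (i, k)) ⬝ᵥ (S.laplacian s *ᵥ fun i => ξ (i, k)))
        volume (t - T) t := IntervalIntegrable.sum _ fun k _ => hL1 _
    refine this.congr fun s _ => ?_
    simp
  simp only [S.outputGram_quadratic hα]
  rw [intervalIntegral.integral_add (hCi fun i k => ξ (i, k)) (hLi.const_mul α),
    intervalIntegral.integral_const_mul, dotProduct_self_eq_blockMean_add hn ξ]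
  have hC0 : 0 ≤ ∫ s in (t - T)..t, ∑ i, (fun k => ξ (i, k)) ⬝ᵥ
      (((S.C i s)ᵀ * S.C i s) *ᵥ fun k => ξ (i, k)) :=
    intervalIntegral.integral_nonneg hab fun s _ => Finset.sum_nonneg fun i _ =>
      (posSemidef_transpose_mul_self (S.C i s)).quadratic_nonneg _
  have hLpsd : ∀ s, (S.laplacian s).PosSemidef := fun s => by
    have := posSemidef_transpose_mul_self (S.incidence s)ᵀ
    rwa [Matrix.transpose_transpose] at this
  have hL : lam * (blockDev ξ ⬝ᵥ blockDev ξ) ≤ ∫ s in (t - T)..t,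
      ∑ k, (fun i => ξ (i, k)) ⬝ᵥ (S.laplacian s *ᵥ fun i => ξ (i, k)) := by
    rw [intervalIntegral.integral_finsetSum fun k _ => hL1 _]
    rw [dotProduct_self_eq_sum_snd, Finset.mul_sum]
    refine Finset.sum_le_sum fun k _ => ?_
    have := hS.laplacian_window hn ht (sum_blockDev hn ξ k) (blockMean ξ k)
    simpa [blockDev, dotProduct] using this
  have hC : ι₁lo * (blockMean ξ ⬝ᵥ blockMean ξ) - 2 * r₂ * T * Real.sqrt
      (n * (blockMean ξ ⬝ᵥ blockMean ξ) * (blockDev ξ ⬝ᵥ blockDev ξ)) ≤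
      ∫ s in (t - T)..t, ∑ i, (fun k => ξ (i, k)) ⬝ᵥ
        (((S.C i s)ᵀ * S.C i s) *ᵥ fun k => ξ (i, k)) := by
    set R := Real.sqrt (n * (blockMean ξ ⬝ᵥ blockMean ξ) * (blockDev ξ ⬝ᵥ blockDev ξ)) with hR
    have h1 := hS.regressor_window ht (blockMean ξ)
    have h2 : ∫ s in (t - T)..t, ((∑ i, blockMean ξ ⬝ᵥ (((S.C i s)ᵀ * S.C i s) *ᵥ blockMean ξ)) -
        2 * r₂ * R) ≤ ∫ s in (t - T)..t, ∑ i, (fun k => ξ (i, k)) ⬝ᵥ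
        (((S.C i s)ᵀ * S.C i s) *ᵥ fun k => ξ (i, k)) := by
      refine intervalIntegral.integral_mono_on hab ((hCi fun _ => blockMean ξ).sub (by simp))
        (hCi fun i k => ξ (i, k)) fun s hs => ?_
      have h := hS.regressor_cross (ha.trans hs.1) (blockMean ξ) (fun i k => blockDev ξ (i, k))
      have e1 : ∑ i, (fun k => blockDev ξ (i, k)) ⬝ᵥ (fun k => blockDev ξ (i, k)) =
          blockDev ξ ⬝ᵥ blockDev ξ := by
        rw [← dotProduct_self_eq_sum_fst]
      have e2 : ∀ i, (blockMean ξ + fun k => blockDev ξ (i, k)) = fun k => ξ (i, k) := by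
        intro i; ext k; simp [blockDev]
      simp only [e1, e2] at h
      exact h
    rw [intervalIntegral.integral_sub (hCi fun _ => blockMean ξ) (by simp),
      intervalIntegral.integral_const, smul_eq_mul] at h2
    have e : (t - (t - T)) * (2 * r₂ * R) = 2 * r₂ * T * R := by ring
    linarith
  have hD0 := dotProduct_self_nonneg' (blockDev ξ)
  have hL0 : 0 ≤ ∫ s in (t - T)..t,
      ∑ k, (fun i => ξ (i, k)) ⬝ᵥ (S.laplacian s *ᵥ fun i => ξ (i, k)) :=
    (mul_nonneg hS.lam_pos.le hD0).trans hL
  refine (iota2lo_mul_le hn hN hα hS.lam_pos.le (dotProduct_self_nonneg' _) hD0).trans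
    (max_le ?_ ?_)
  · have := mul_le_mul_of_nonneg_left hL hα
    rw [mul_assoc]
    linarith
  · have := mul_nonneg hα hL0
    linarith

end SensorNetwork

/-! ### Constants and consequences of the matrix inequalities -/

/-- Rationalising the quotient gives √ι₃lo = l/(√(h - l + φ₁l) + √h). The denominator is at least (1
+ √φ₁)√l, because h - l + φ₁l ≥ φ₁l and h ≥ l. -/
theorem iota3lo_le {r₁ l h : ℝ} (hl : 0 ≤ l) (hlh : l ≤ h) (hh : 0 < h) :
    iota3lo r₁ l h * (1 + Real.sqrt (phi1 r₁ h)) ^ 2 ≤ l := by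
  have hφ : 0 ≤ phi1 r₁ h := by unfold phi1; positivity
  set φ := phi1 r₁ h with hφdef
  set σ := Real.sqrt φ with hσ
  have hσ0 : 0 ≤ σ := Real.sqrt_nonneg _
  have hσ2 : σ ^ 2 = φ := Real.sq_sqrt hφ
  unfold iota3lo
  rw [← hφdef]
  split_ifs with h1
  · have : σ = 1 := by rw [hσ, h1, Real.sqrt_one]
    rw [this, div_mul_eq_mul_div, div_le_iff₀ (by positivity)]
    nlinarith
  · have hg : 0 ≤ h - l + φ * l := by nlinarith [mul_nonneg hφ hl]
    have hs1 : σ * Real.sqrt l ≤ Real.sqrt (h - l + φ * l) := by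
      rw [hσ, ← Real.sqrt_mul hφ]
      exact Real.sqrt_le_sqrt (by linarith)
    have hs2 : Real.sqrt l ≤ Real.sqrt h := Real.sqrt_le_sqrt hlh
    have hsum : 0 < Real.sqrt (h - l + φ * l) + Real.sqrt h :=
      add_pos_of_nonneg_of_pos (Real.sqrt_nonneg _) (Real.sqrt_pos.2 hh)
    have e : (Real.sqrt (h - l + φ * l) - Real.sqrt h) / (φ - 1) =
        l / (Real.sqrt (h - l + φ * l) + Real.sqrt h) := by
      rw [div_eq_div_iff (sub_ne_zero.2 h1) hsum.ne']
      have a1 := Real.mul_self_sqrt hg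
      have a2 := Real.mul_self_sqrt hh.le
      linear_combination a1 - a2
    rw [e, div_pow, div_mul_eq_mul_div, div_le_iff₀ (by positivity)]
    have h3 : l * (1 + σ) ^ 2 ≤ (Real.sqrt (h - l + φ * l) + Real.sqrt h) ^ 2 := by
      have h4 : (1 + σ) * Real.sqrt l ≤ Real.sqrt (h - l + φ * l) + Real.sqrt h := by linarith
      have h5 := pow_le_pow_left₀ (by positivity) h4 2
      rw [mul_pow, Real.sq_sqrt hl] at h5
      linarith
    nlinarith [mul_le_mul_of_nonneg_left h3 hl]

/-! ### Scalar consequences of the two matrix inequalities. -/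

section MatrixInequalities

theorem Matrix.PosDef.block_le {X : Type*} [Fintype X] [DecidableEq X] {p : ℕ} {c : ℝ}
    {Q : Matrix (Fin p) X ℝ}
    (h : (Matrix.fromBlocks (c • (1 : Matrix X X ℝ)) (-Qᵀ) (-Q)
      (1 : Matrix (Fin p) (Fin p) ℝ)).PosDef) (x : X → ℝ) :
    (Q *ᵥ x) ⬝ᵥ (Q *ᵥ x) ≤ c * (x ⬝ᵥ x) := by
  -- Schur complement: Qx minimises the block form in its second argument.
  have := h.posSemidef.quadratic_nonneg (Sum.elim x (Q *ᵥ x))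
  rw [Matrix.fromBlocks_mulVec] at this
  simp only [Sum.elim_comp_inl, Sum.elim_comp_inr, dotProduct, Fintype.sum_sum_type,
    Sum.elim_inl, Sum.elim_inr] at this
  simp only [← dotProduct.eq_1, Matrix.neg_mulVec, Matrix.smul_mulVec, Matrix.one_mulVec] at this
  change 0 ≤ x ⬝ᵥ (c • x + -(Qᵀ *ᵥ (Q *ᵥ x))) + (Q *ᵥ x) ⬝ᵥ (-(Q *ᵥ x) + Q *ᵥ x) at this
  rw [neg_add_cancel, dotProduct_zero, dotProduct_add, dotProduct_neg, dotProduct_smul,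
    smul_eq_mul, Matrix.dotProduct_mulVec, Matrix.vecMul_transpose] at this
  linarith

variable {O X : Type} [Fintype O] [Fintype X] [DecidableEq O] [DecidableEq X] {p r : ℕ}
  {T γ γ₁ γ₂ c₁ c₂ ι₃lo ι₃hi r₄ : ℝ} {D₁ : Matrix X (Fin r) ℝ} {D₂ : Matrix O (Fin r) ℝ}
  {Q : Matrix (Fin p) X ℝ} {W : Matrix (Fin p) (Fin r) ℝ}

theorem gain_le_of_tuningMatrix [Nonempty O]
    (h : (-tuningMatrix T γ γ₁ γ₂ c₁ c₂ ι₃lo ι₃hi r₄ D₁ D₂ Q W).PosSemidef) : c₂ * T ≤ c₁ := by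
  obtain ⟨o⟩ := ‹Nonempty O›
  have := h.diag_nonneg (i := Sum.inl (Sum.inl (Sum.inl o)))
  simp [tuningMatrix, Phi11] at this
  linarith

/-- The matrix is tested on (0, 0, Wd, d, w). The third entry maximises -|y|² + 2yᵀWd and
contributes |d|², the 1 in γ - 1. The choice w = -(k/γ₂)D₁d maximises over the last block and
contributes (k²/γ₂)|D₁d|². -/
theorem dissipation_of_tuningMatrix (hW : Wᵀ * W = 1) (hc₂ : 0 < c₂)
    (hι : 0 < ι₃lo) (hr₄ : 0 ≤ r₄) (hγ₁ : 0 ≤ γ₁) (hγ₂ : 0 < γ₂)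
    (h : (-tuningMatrix T γ γ₁ γ₂ c₁ c₂ ι₃lo ι₃hi r₄ D₁ D₂ Q W).PosSemidef) (d : Fin r → ℝ) :
    c₁ * ((D₂ *ᵥ d) ⬝ᵥ (D₂ *ᵥ d)) +
      4 * c₁ ^ 2 / (c₂ * ι₃lo * γ₂) * ((D₁ *ᵥ d) ⬝ᵥ (D₁ *ᵥ d)) ≤ (γ - 1) * (d ⬝ᵥ d) := by
  set k := 2 * c₁ / Real.sqrt (c₂ * ι₃lo) with hk
  have hk2 : k ^ 2 = 4 * c₁ ^ 2 / (c₂ * ι₃lo) := by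
    rw [hk, div_pow, Real.sq_sqrt (by positivity)]; ring
  have hWW : (W *ᵥ d) ⬝ᵥ (W *ᵥ d) = d ⬝ᵥ d := by
    rw [← quadratic_transpose_mul_self, hW, Matrix.one_mulVec]
  have hWt : Wᵀ *ᵥ (W *ᵥ d) = d := by
    rw [Matrix.mulVec_mulVec, hW, Matrix.one_mulVec]
  set w : X → ℝ := -(k / γ₂) • (D₁ *ᵥ d) with hw
  have key := h.quadratic_nonneg
    (Sum.elim (Sum.elim (Sum.elim 0 0) (Sum.elim (W *ᵥ d) d)) w)
  have h44 : d ⬝ᵥ (phi44 γ γ₁ c₁ c₂ ι₃lo ι₃hi r₄ D₁ D₂ *ᵥ d) =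
      8 * c₂ * ι₃hi ^ 2 / ι₃lo * ((D₁ *ᵥ d) ⬝ᵥ (D₁ *ᵥ d)) +
      (c₁ + 8 * c₂ * ι₃hi ^ 2 * r₄ * γ₁ / ι₃lo) * ((D₂ *ᵥ d) ⬝ᵥ (D₂ *ᵥ d)) - γ * (d ⬝ᵥ d) := by
    simp only [phi44, Matrix.sub_mulVec, Matrix.add_mulVec, Matrix.smul_mulVec,
      Matrix.one_mulVec, dotProduct_sub, dotProduct_add, dotProduct_smul, smul_eq_mul,
      quadratic_transpose_mul_self]
  have hD : d ⬝ᵥ (D₁ᵀ *ᵥ w) = -(k / γ₂) * ((D₁ *ᵥ d) ⬝ᵥ (D₁ *ᵥ d)) := by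
    rw [Matrix.dotProduct_mulVec, Matrix.vecMul_transpose, hw, dotProduct_smul, smul_eq_mul]
  have hww : w ⬝ᵥ w = (k / γ₂) ^ 2 * ((D₁ *ᵥ d) ⬝ᵥ (D₁ *ᵥ d)) := by
    rw [hw, dotProduct_smul, smul_dotProduct, smul_eq_mul, smul_eq_mul]; ring
  have expand : (Sum.elim (Sum.elim (Sum.elim 0 0) (Sum.elim (W *ᵥ d) d)) w) ⬝ᵥ
      ((tuningMatrix T γ γ₁ γ₂ c₁ c₂ ι₃lo ι₃hi r₄ D₁ D₂ Q W) *ᵥ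
        (Sum.elim (Sum.elim (Sum.elim 0 0) (Sum.elim (W *ᵥ d) d)) w)) =
      (W *ᵥ d) ⬝ᵥ (-(W *ᵥ d) + W *ᵥ d) +
      d ⬝ᵥ (Wᵀ *ᵥ (W *ᵥ d) + phi44 γ γ₁ c₁ c₂ ι₃lo ι₃hi r₄ D₁ D₂ *ᵥ d + -k • (D₁ᵀ *ᵥ w)) +
      w ⬝ᵥ (-k • (D₁ *ᵥ d) + -γ₂ • w) := by
    simp only [tuningMatrix, Phi11, Phi12, Matrix.fromBlocks_mulVec, Sum.elim_comp_inl,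
      Sum.elim_comp_inr, Matrix.transpose_fromRows, Matrix.fromRows_mulVec,
      Matrix.fromCols_mulVec_sumElim, Matrix.zero_mulVec, Matrix.mulVec_zero, add_zero, zero_add,
      Matrix.transpose_zero, Matrix.transpose_smul, Matrix.transpose_transpose,
      Matrix.smul_mulVec, Matrix.one_mulVec, Matrix.neg_mulVec, sumElim_dotProduct_sumElim,
      zero_dotProduct, ← Sum.elim_add_add, ← hk]
  rw [Matrix.neg_mulVec, dotProduct_neg, expand, neg_add_cancel, dotProduct_zero, zero_add, hWt,
    dotProduct_add, dotProduct_add, dotProduct_add, h44, dotProduct_smul, dotProduct_smul,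
    dotProduct_smul, hD, hww] at key
  have hwD : w ⬝ᵥ (D₁ *ᵥ d) = -(k / γ₂) * ((D₁ *ᵥ d) ⬝ᵥ (D₁ *ᵥ d)) := by
    rw [hw, smul_dotProduct, smul_eq_mul]
  rw [hwD] at key
  have hd1 := dotProduct_self_nonneg' (D₁ *ᵥ d)
  have hd2 := dotProduct_self_nonneg' (D₂ *ᵥ d)
  -- The terms containing `ι₃hi` are nonnegative and are discarded.
  have p1 : 0 ≤ 8 * c₂ * ι₃hi ^ 2 / ι₃lo * ((D₁ *ᵥ d) ⬝ᵥ (D₁ *ᵥ d)) := by positivity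
  have p2 : 0 ≤ 8 * c₂ * ι₃hi ^ 2 * r₄ * γ₁ / ι₃lo * ((D₂ *ᵥ d) ⬝ᵥ (D₂ *ᵥ d)) := by positivity
  have e : 4 * c₁ ^ 2 / (c₂ * ι₃lo * γ₂) = k ^ 2 / γ₂ := by
    rw [hk2, div_div]
  rw [e]
  simp only [smul_eq_mul] at key
  have e2 : γ₂ * ((k / γ₂) ^ 2 * ((D₁ *ᵥ d) ⬝ᵥ (D₁ *ᵥ d))) =
      k ^ 2 / γ₂ * ((D₁ *ᵥ d) ⬝ᵥ (D₁ *ᵥ d)) := by field_simp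
  have e3 : k * (k / γ₂ * ((D₁ *ᵥ d) ⬝ᵥ (D₁ *ᵥ d))) =
      k ^ 2 / γ₂ * ((D₁ *ᵥ d) ⬝ᵥ (D₁ *ᵥ d)) := by field_simp
  nlinarith

end MatrixInequalities

/-! ### Consequences of a lower bound on the gain matrix. -/

section Gain

theorem posDef_of_sub_smul_one {ι : Type*} [DecidableEq ι] {G : Matrix ι ι ℝ} {g : ℝ} (hg : 0 < g)
    (hG : (G - g • (1 : Matrix ι ι ℝ)).PosSemidef) : G.PosDef := by
  have h : (g • (1 : Matrix ι ι ℝ)).PosDef := Matrix.PosDef.one.smul hg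
  simpa using Matrix.PosDef.posSemidef_add hG h

variable {ι : Type*} [Fintype ι] [DecidableEq ι] {G : Matrix ι ι ℝ} {g : ℝ}

theorem smul_le_quadratic (hG : (G - g • (1 : Matrix ι ι ℝ)).PosSemidef) (v : ι → ℝ) :
    g * (v ⬝ᵥ v) ≤ v ⬝ᵥ (G *ᵥ v) := by
  have h := hG.quadratic_nonneg v
  rw [Matrix.sub_mulVec, dotProduct_sub, Matrix.smul_mulVec, Matrix.one_mulVec, dotProduct_smul,
    smul_eq_mul] at h
  linarith

theorem le_norm_of_sub_smul_one [Nonempty ι] (hG : (G - g • (1 : Matrix ι ι ℝ)).PosSemidef) :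
    g ≤ ‖G‖ := by
  obtain ⟨i⟩ := ‹Nonempty ι›
  have h := (smul_le_quadratic hG (Pi.single i 1)).trans (quadratic_le_norm G (Pi.single i 1))
  simpa using h

/-- With w = G⁻¹u, coercivity and Cauchy-Schwarz give g|w|² ≤ wᵀu ≤ |w||u|. -/
theorem inv_mulVec_dotProduct_self_le (hg : 0 < g)
    (hG : (G - g • (1 : Matrix ι ι ℝ)).PosSemidef) (u : ι → ℝ) :
    g ^ 2 * ((G⁻¹ *ᵥ u) ⬝ᵥ (G⁻¹ *ᵥ u)) ≤ u ⬝ᵥ u := by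
  have hdet : IsUnit G.det := (Matrix.isUnit_iff_isUnit_det _).1
    (posDef_of_sub_smul_one hg hG).isUnit
  set w := G⁻¹ *ᵥ u with hw
  have hGw : G *ᵥ w = u := by
    rw [hw, Matrix.mulVec_mulVec, Matrix.mul_nonsing_inv _ hdet, Matrix.one_mulVec]
  have h1 := smul_le_quadratic hG w
  rw [hGw] at h1
  have h2 := dotProduct_sq_le w u
  have h3 := dotProduct_self_nonneg' w
  rcases h3.eq_or_lt with h | h
  · rw [← h, mul_zero]; exact dotProduct_self_nonneg' u
  · have h4 := mul_self_le_mul_self (by positivity) h1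
    have h5 : (g ^ 2 * (w ⬝ᵥ w)) * (w ⬝ᵥ w) ≤ (u ⬝ᵥ u) * (w ⬝ᵥ w) := by nlinarith
    exact le_of_mul_le_mul_right h5 h

end Gain

/-! ### Dissipation along a trajectory -/

/-- The left side is 6μ, the cost in |u|² of including μ|f|² in the dissipation; the right side is
one of the four units of c₁²/(c₂ι₃γ₂) that the matrix inequality supplies. -/
theorem weight_le {T r₁ r₄ l ι₃ c₁ c₂ γ₂ σ : ℝ} (hσ : 0 ≤ σ) (hT : 0 < T)
    (hr₄ : 0 < r₄) (hc₂ : 0 < c₂) (hι : 0 < ι₃) (hlh : l ≤ T * r₄)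
    (hιl : ι₃ * (1 + σ) ^ 2 ≤ l) (hc : c₂ * T ≤ c₁) (hγ₂ : 0 < γ₂) (hγr : γ₂ ≤ r₁ ^ 2) :
    5 * (σ / (1 + σ)) * c₁ / (r₁ ^ 2 * r₄) ≤ c₁ ^ 2 / (c₂ * ι₃ * γ₂) := by
  have hr₁ : 0 < r₁ ^ 2 := hγ₂.trans_le hγr
  have hc₁ : 0 < c₁ := (mul_pos hc₂ hT).trans_le hc
  have h1σ : 0 < 1 + σ := by linarith
  have h1 : c₂ * ι₃ * (1 + σ) ^ 2 ≤ c₁ * r₄ := by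
    calc c₂ * ι₃ * (1 + σ) ^ 2 = c₂ * (ι₃ * (1 + σ) ^ 2) := by ring
      _ ≤ c₂ * (T * r₄) := mul_le_mul_of_nonneg_left (hιl.trans hlh) hc₂.le
      _ = (c₂ * T) * r₄ := by ring
      _ ≤ c₁ * r₄ := by gcongr
  -- The difference is σ³ + 2σ² + (1 - σ)².
  have h2 : 5 * σ ≤ (1 + σ) ^ 3 := by nlinarith [sq_nonneg (1 - σ), pow_nonneg hσ 3, sq_nonneg σ]
  have h3 : 5 * σ * (c₂ * ι₃ * γ₂) ≤ c₁ * (r₁ ^ 2 * r₄) * (1 + σ) := by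
    have h4 : 5 * σ * (c₂ * ι₃ * γ₂) ≤ (1 + σ) * (c₂ * ι₃ * (1 + σ) ^ 2) * γ₂ := by
      have := mul_le_mul_of_nonneg_right h2 (by positivity : 0 ≤ c₂ * ι₃ * γ₂)
      linarith
    refine h4.trans ?_
    calc (1 + σ) * (c₂ * ι₃ * (1 + σ) ^ 2) * γ₂ ≤ (1 + σ) * (c₁ * r₄) * r₁ ^ 2 := by gcongr
      _ = _ := by ring
  have e : 5 * (σ / (1 + σ)) * c₁ / (r₁ ^ 2 * r₄) =
      5 * σ * c₁ / ((1 + σ) * (r₁ ^ 2 * r₄)) := by field_simp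
  rw [e, div_le_div_iff₀ (by positivity) (by positivity)]
  nlinarith

/-- The window estimate reduces to c₂ι₃X ≤ c₁Z + (6/5)μF. Taking 5/6 of it and inserting the energy
estimate leaves the coefficient 5/6 - 1/3 = 1/2 in front of c₂ι₃X. -/
theorem energy_add_window_le {T r₁ r₄ l ι₃ c₁ c₂ σ μ X Y F V x₀₀ E : ℝ} (hσ : 0 < σ) (hT : 0 < T)
    (hr₄ : 0 < r₄) (hr₁ : 0 < r₁) (hc₂ : 0 < c₂)
    (hσr : σ ^ 2 = 1 / 2 * r₁ ^ 2 * (T * r₄) ^ 2)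
    (hιl : ι₃ * (1 + σ) ^ 2 ≤ l) (hc : c₂ * T ≤ c₁)
    (hμ : μ = 5 * (σ / (1 + σ)) * c₁ / (r₁ ^ 2 * r₄) / 6)
    (hX : 0 ≤ X) (hY : 0 ≤ Y) (hF : 0 ≤ F) (hx₀ : 0 ≤ x₀₀)
    (henergy : c₁ * Y + μ * F ≤ 1 / 3 * (c₂ * ι₃) * X + V + E)
    (hwindow : l * X ≤ (1 + σ) * T * (T * r₄ * x₀₀ + Y) +
      (1 + 1 / σ) * r₄ * (T ^ 2 / 2) * T * F) :
    c₂ * ι₃ / 2 * X ≤ V + c₁ * (T * r₄ * x₀₀) + E := by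
  have hc₁ : 0 < c₁ := (mul_pos hc₂ hT).trans_le hc
  have h1σ : 0 < 1 + σ := by linarith
  set Z := T * r₄ * x₀₀ + Y with hZ
  have hZ0 : 0 ≤ Z := by positivity
  have h1 : ι₃ * (1 + σ) * X ≤ T * Z + r₄ * T ^ 3 / (2 * σ) * F := by
    have h := (mul_le_mul_of_nonneg_right hιl hX).trans hwindow
    have e : (1 + σ) * T * Z + (1 + 1 / σ) * r₄ * (T ^ 2 / 2) * T * F =
        (1 + σ) * (T * Z + r₄ * T ^ 3 / (2 * σ) * F) := by field_simp; ring
    rw [e, show ι₃ * (1 + σ) ^ 2 * X = (1 + σ) * (ι₃ * (1 + σ) * X) by ring] at h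
    exact le_of_mul_le_mul_left h h1σ
  have h2 : c₂ * ι₃ * X * (1 + σ) ≤ c₁ * (Z + r₄ * T ^ 2 / (2 * σ) * F) := by
    calc c₂ * ι₃ * X * (1 + σ) = c₂ * (ι₃ * (1 + σ) * X) := by ring
      _ ≤ c₂ * (T * Z + r₄ * T ^ 3 / (2 * σ) * F) := by gcongr
      _ = (c₂ * T) * (Z + r₄ * T ^ 2 / (2 * σ) * F) := by ring
      _ ≤ _ := by gcongr
  have h3 : c₁ * (Z + r₄ * T ^ 2 / (2 * σ) * F) = c₁ * Z + 6 / 5 * μ * F * (1 + σ) := by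
    -- This identity is σ² = φ₁, and it is what makes μ match the window's coefficient of F.
    have hσT : r₄ * T ^ 2 / (2 * σ) = σ / (r₁ ^ 2 * r₄) := by
      rw [div_eq_div_iff (by positivity) (by positivity)]
      linear_combination (-2) * hσr
    rw [hσT, hμ]
    field_simp
  have h4 : c₂ * ι₃ * X ≤ c₁ * Z + 6 / 5 * μ * F := by
    rw [h3] at h2
    have h5 : c₁ * Z ≤ c₁ * Z * (1 + σ) := le_mul_of_one_le_right (by positivity) (by linarith)
    have : c₂ * ι₃ * X * (1 + σ) ≤ (c₁ * Z + 6 / 5 * μ * F) * (1 + σ) := by linarith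
    exact le_of_mul_le_mul_right this h1σ
  have h6 : 0 ≤ c₁ * (T * r₄ * x₀₀) := by positivity
  have h7 : 0 ≤ c₁ * Y := by positivity
  have h8 : c₁ * Z = c₁ * (T * r₄ * x₀₀) + c₁ * Y := by rw [hZ]; ring
  linarith

theorem add_dotProduct_self_le {X : Type*} [Fintype X] (p q : X → ℝ) :
    (p + q) ⬝ᵥ (p + q) ≤ 6 / 5 * (p ⬝ᵥ p) + 6 * (q ⬝ᵥ q) := by
  have h := dotProduct_self_nonneg' (p - (5 : ℝ) • q)
  simp only [sub_dotProduct, dotProduct_sub, smul_dotProduct, dotProduct_smul, smul_eq_mul,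
    dotProduct_comm q p] at h
  simp only [add_dotProduct, dotProduct_add, dotProduct_comm q p]
  linarith

/-! ### The dissipation inequality at a fixed time. -/

section Pointwise

variable {O X : Type*} [Fintype O] [Fintype X] [DecidableEq X] {L : Matrix O X ℝ}
  {G : Matrix X X ℝ} {r₁ r₄ : ℝ}

theorem feedback_dotProduct_self_le (hr₄ : 0 ≤ r₄)
    (hL : ∀ v : X → ℝ, v ⬝ᵥ ((Lᵀ * L) *ᵥ v) ≤ r₄ * (v ⬝ᵥ v)) (hG : ‖G‖ ≤ r₁)
    (g : O → ℝ) (u : X → ℝ) :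
    (-(G *ᵥ (Lᵀ *ᵥ g)) - u) ⬝ᵥ (-(G *ᵥ (Lᵀ *ᵥ g)) - u) ≤
      6 / 5 * (r₁ ^ 2 * r₄) * (g ⬝ᵥ g) + 6 * (u ⬝ᵥ u) := by
  have h := add_dotProduct_self_le (G *ᵥ (Lᵀ *ᵥ g)) u
  rw [← neg_add', neg_dotProduct_neg]
  have h1 := mulVec_dotProduct_self_le G (Lᵀ *ᵥ g)
  have h2 := transpose_mulVec_dotProduct_self_le hr₄ hL g
  have h3 : ‖G‖ ^ 2 ≤ r₁ ^ 2 := pow_le_pow_left₀ (norm_nonneg _) hG 2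
  have h4 : ‖G‖ ^ 2 * ((Lᵀ *ᵥ g) ⬝ᵥ (Lᵀ *ᵥ g)) ≤ r₁ ^ 2 * (r₄ * (g ⬝ᵥ g)) :=
    mul_le_mul h3 h2 (dotProduct_self_nonneg' _) (sq_nonneg _)
  linarith

/-- The four units of c₁²/(c₂ι₃γ₂)|u|² in ε are spent as 3 + 1: three on the cross term between G⁻¹u
and x, which also costs (1/3)c₂ι₃|x|², and one on the share of |f|² caused by u. The other share of
|f|² is paid by c₁|g|², since κ ≤ 1. -/
theorem dissipation_le {c₁ c₂ ι₃ γ₂ κ ε : ℝ} (hr₄ : 0 < r₄) (hr₁ : 0 < r₁)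
    (hL : ∀ v : X → ℝ, v ⬝ᵥ ((Lᵀ * L) *ᵥ v) ≤ r₄ * (v ⬝ᵥ v)) (hG : ‖G‖ ≤ r₁)
    (hGγ : (G - Real.sqrt γ₂ • (1 : Matrix X X ℝ)).PosSemidef)
    (hc₁ : 0 < c₁) (hc₂ : 0 < c₂) (hι : 0 < ι₃) (hγ₂ : 0 < γ₂) (hκ0 : 0 ≤ κ) (hκ1 : κ ≤ 1)
    (hκ : 5 * κ * c₁ / (r₁ ^ 2 * r₄) ≤ c₁ ^ 2 / (c₂ * ι₃ * γ₂)) (x u : X → ℝ) (b : O → ℝ)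
    (hε : c₁ * (b ⬝ᵥ b) + 4 * c₁ ^ 2 / (c₂ * ι₃ * γ₂) * (u ⬝ᵥ u) ≤ ε) (f : X → ℝ)
    (hf : f = -(G *ᵥ (Lᵀ *ᵥ (L *ᵥ x - b))) - u) :
    c₁ * (2 * (f ⬝ᵥ (G⁻¹ *ᵥ x))) + (c₁ * (x ⬝ᵥ ((Lᵀ * L) *ᵥ x)) +
      5 * κ * c₁ / (r₁ ^ 2 * r₄) / 6 * (f ⬝ᵥ f)) ≤ 1 / 3 * (c₂ * ι₃) * (x ⬝ᵥ x) + ε := by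
  have hγ : 0 < Real.sqrt γ₂ := Real.sqrt_pos.2 hγ₂
  have hpd := posDef_of_sub_smul_one hγ hGγ
  have hdet : IsUnit G.det := (Matrix.isUnit_iff_isUnit_det _).1 hpd.isUnit
  have hinv : G⁻¹.IsHermitian := hpd.isHermitian.inv
  set g := L *ᵥ x - b with hg
  set P := G⁻¹ *ᵥ u with hP
  have h1 : f ⬝ᵥ (G⁻¹ *ᵥ x) = -(g ⬝ᵥ (L *ᵥ x)) - P ⬝ᵥ x := by
    rw [hinv.dotProduct_mulVec_comm, hf, Matrix.mulVec_sub, Matrix.mulVec_neg,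
      Matrix.mulVec_mulVec, Matrix.nonsing_inv_mul _ hdet, Matrix.one_mulVec, dotProduct_sub,
      dotProduct_neg, Matrix.dotProduct_mulVec, Matrix.vecMul_transpose, ← hP,
      dotProduct_comm x P, dotProduct_comm (L *ᵥ x) g]
  -- Polarisation for Lx - g = b: it keeps |g|² as a dissipated quantity alongside |Lx|².
  have h2 : 2 * (g ⬝ᵥ (L *ᵥ x)) = x ⬝ᵥ ((Lᵀ * L) *ᵥ x) + g ⬝ᵥ g - b ⬝ᵥ b := by
    rw [quadratic_transpose_mul_self, hg]
    simp only [sub_dotProduct, dotProduct_sub, dotProduct_comm b (L *ᵥ x)]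
    ring
  have h3 : -(2 * c₁ * (P ⬝ᵥ x)) ≤ 1 / 3 * (c₂ * ι₃) * (x ⬝ᵥ x) +
      3 * (c₁ ^ 2 / (c₂ * ι₃ * γ₂)) * (u ⬝ᵥ u) := by
    have h := dotProduct_self_nonneg' ((1 / 3 * (c₂ * ι₃)) • x + c₁ • P)
    simp only [add_dotProduct, dotProduct_add, smul_dotProduct, dotProduct_smul, smul_eq_mul,
      dotProduct_comm x P] at h
    have hPu := inv_mulVec_dotProduct_self_le hγ hGγ u
    rw [Real.sq_sqrt hγ₂.le, ← hP] at hPu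
    have hPu' : P ⬝ᵥ P ≤ (u ⬝ᵥ u) / γ₂ := by rw [le_div_iff₀ hγ₂]; linarith
    have e : 3 * (c₁ ^ 2 / (c₂ * ι₃ * γ₂)) * (u ⬝ᵥ u) =
        3 * c₁ ^ 2 / (c₂ * ι₃) * ((u ⬝ᵥ u) / γ₂) := by field_simp
    have h5 : 3 * c₁ ^ 2 / (c₂ * ι₃) * (P ⬝ᵥ P) ≤ 3 * c₁ ^ 2 / (c₂ * ι₃) * ((u ⬝ᵥ u) / γ₂) :=
      mul_le_mul_of_nonneg_left hPu' (by positivity)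
    rw [e]
    refine le_trans ?_ (add_le_add_right h5 _)
    rw [← sub_nonneg]
    have e2 : 1 / 3 * (c₂ * ι₃) * (x ⬝ᵥ x) + 3 * c₁ ^ 2 / (c₂ * ι₃) * (P ⬝ᵥ P) -
        -(2 * c₁ * (P ⬝ᵥ x)) = 3 / (c₂ * ι₃) * (1 / 3 * (c₂ * ι₃) * (1 / 3 * (c₂ * ι₃) * (x ⬝ᵥ x)) +
          c₁ * (1 / 3 * (c₂ * ι₃) * (P ⬝ᵥ x)) +
          (1 / 3 * (c₂ * ι₃) * (c₁ * (P ⬝ᵥ x)) + c₁ * (c₁ * (P ⬝ᵥ P)))) := by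
      field_simp
      ring
    rw [e2]
    refine mul_nonneg (by positivity) ?_
    linarith
  have h4 : 5 * κ * c₁ / (r₁ ^ 2 * r₄) / 6 * (f ⬝ᵥ f) ≤
      c₁ * (g ⬝ᵥ g) + c₁ ^ 2 / (c₂ * ι₃ * γ₂) * (u ⬝ᵥ u) := by
    have h := feedback_dotProduct_self_le hr₄.le hL hG g u
    rw [← hf] at h
    have h5 := mul_le_mul_of_nonneg_left h
      (by positivity : 0 ≤ 5 * κ * c₁ / (r₁ ^ 2 * r₄) / 6)
    have e : 5 * κ * c₁ / (r₁ ^ 2 * r₄) / 6 *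
        (6 / 5 * (r₁ ^ 2 * r₄) * (g ⬝ᵥ g) + 6 * (u ⬝ᵥ u)) =
        κ * (c₁ * (g ⬝ᵥ g)) + 5 * κ * c₁ / (r₁ ^ 2 * r₄) * (u ⬝ᵥ u) := by
      field_simp
    rw [e] at h5
    have h6 : κ * (c₁ * (g ⬝ᵥ g)) ≤ c₁ * (g ⬝ᵥ g) :=
      mul_le_of_le_one_left (mul_nonneg hc₁.le (dotProduct_self_nonneg' g)) hκ1
    have h7 := mul_le_mul_of_nonneg_right hκ (dotProduct_self_nonneg' u)
    linarith
  have e4 : 4 * c₁ ^ 2 / (c₂ * ι₃ * γ₂) * (u ⬝ᵥ u) =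
      4 * (c₁ ^ 2 / (c₂ * ι₃ * γ₂) * (u ⬝ᵥ u)) := by ring
  rw [e4] at hε
  have e5 : c₁ * (2 * (f ⬝ᵥ (G⁻¹ *ᵥ x))) =
      -(c₁ * (x ⬝ᵥ ((Lᵀ * L) *ᵥ x))) - c₁ * (g ⬝ᵥ g) + c₁ * (b ⬝ᵥ b) - 2 * c₁ * (P ⬝ᵥ x) := by
    rw [h1]
    linear_combination (-c₁) * h2
  rw [e5]
  linarith

end Pointwise

/-! ### Square-integrable signals -/

section Signals

variable {ι : Type} [Fintype ι] {u : ℝ → ι → ℝ}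

theorem MemL2.intervalIntegrable (hu : MemL2 u) {t : ℝ} (ht : 0 ≤ t) :
    IntervalIntegrable (fun s => u s ⬝ᵥ u s) volume 0 t := by
  rw [intervalIntegrable_iff_integrableOn_Ioc_of_le ht]
  exact hu.2.mono_set (Set.Ioc_subset_Icc_self.trans Set.Icc_subset_Ici_self)

theorem MemL2.integral_le (hu : MemL2 u) {t : ℝ} (ht : 0 ≤ t) :
    ∫ s in (0 : ℝ)..t, u s ⬝ᵥ u s ≤ ∫ s in Set.Ici (0 : ℝ), u s ⬝ᵥ u s := by
  rw [intervalIntegral.integral_of_le ht]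
  exact setIntegral_mono_set hu.2 (Filter.Eventually.of_forall fun s => dotProduct_self_nonneg' _)
    (Filter.Eventually.of_forall (Set.Ioc_subset_Icc_self.trans Set.Icc_subset_Ici_self))

theorem MemL2.of_integral_le (hm : ∀ i, AEStronglyMeasurable (fun t => u t i)
      (volume.restrict (Set.Ici 0))) {B : ℝ}
    (hi : ∀ t, 0 ≤ t → IntervalIntegrable (fun s => u s ⬝ᵥ u s) volume 0 t)
    (hB : ∀ t, 0 ≤ t → ∫ s in (0 : ℝ)..t, u s ⬝ᵥ u s ≤ B) :
    MemL2 u ∧ ∫ s in Set.Ici (0 : ℝ), u s ⬝ᵥ u s ≤ B := by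
  have hint : IntegrableOn (fun s => u s ⬝ᵥ u s) (Set.Ioi 0) := by
    refine integrableOn_Ioi_of_intervalIntegral_norm_bounded B 0 (b := fun k : ℕ => (k : ℝ))
      (l := Filter.atTop) (fun k => ?_) tendsto_natCast_atTop_atTop
      (Filter.Eventually.of_forall fun k => ?_)
    · rw [← intervalIntegrable_iff_integrableOn_Ioc_of_le (Nat.cast_nonneg k)]
      exact hi k (Nat.cast_nonneg k)
    · simp only [Real.norm_of_nonneg (dotProduct_self_nonneg' _)]
      exact hB k (Nat.cast_nonneg k)
  refine ⟨⟨hm, (integrableOn_Ici_iff_integrableOn_Ioi).2 hint⟩, ?_⟩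
  rw [integral_Ici_eq_integral_Ioi]
  refine le_of_tendsto (intervalIntegral_tendsto_integral_Ioi 0 hint tendsto_natCast_atTop_atTop)
    (Filter.Eventually.of_forall fun k : ℕ => ?_)
  exact hB k (Nat.cast_nonneg k)

theorem l2norm_le_of_integral_le {κ : Type} [Fintype κ] {z : ℝ → κ → ℝ} {γ B : ℝ} (hγ : 0 ≤ γ)
    (hB : 0 ≤ B) (h : ∫ s in Set.Ici (0 : ℝ), z s ⬝ᵥ z s ≤
      B + γ * ∫ s in Set.Ici (0 : ℝ), u s ⬝ᵥ u s) :
    l2norm z ≤ Real.sqrt γ * l2norm u + Real.sqrt B := by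
  have hu : 0 ≤ ∫ s in Set.Ici (0 : ℝ), u s ⬝ᵥ u s :=
    integral_nonneg fun s => dotProduct_self_nonneg' _
  unfold l2norm
  rw [Real.sqrt_le_iff]
  refine ⟨by positivity, h.trans ?_⟩
  rw [add_sq, mul_pow, Real.sq_sqrt hγ, Real.sq_sqrt hu, Real.sq_sqrt hB]
  have : 0 ≤ 2 * (Real.sqrt γ * Real.sqrt (∫ s in Set.Ici (0 : ℝ), u s ⬝ᵥ u s)) * Real.sqrt B := by
    positivity
  linarith

theorem continuousOn_Ici_of_eq_primitive {f v : ℝ → ℝ} {c : ℝ}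
    (hf : ∀ t, 0 ≤ t → IntervalIntegrable f volume 0 t)
    (hv : ∀ t, 0 ≤ t → v t = c + ∫ s in (0 : ℝ)..t, f s) : ContinuousOn v (Set.Ici 0) := by
  intro t ht
  have h := continuousOn_of_eq_primitive (τ := t + 1) (by linarith [Set.mem_Ici.1 ht])
    (hf _ (by linarith [Set.mem_Ici.1 ht])) (fun s hs => hv s hs.1)
  refine (h t ⟨ht, by linarith⟩).mono_of_mem_nhdsWithin ?_
  rw [← Set.Ici_inter_Iic]
  exact inter_mem_nhdsWithin _ (Iic_mem_nhds (by linarith))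

end Signals

/-! ### The disturbed error dynamics -/

namespace SensorNetwork

variable {n N Ny r : ℕ} {S : SensorNetwork n N Ny} {T ι₁lo ι₁hi r₂ r₃ lam α r₁ E : ℝ}
  {Γ : Fin n → Matrix (Fin N) (Fin N) ℝ} {Δ₁ : Matrix (Fin N) (Fin r) ℝ}
  {D₂ : ∀ t, Matrix (S.Out t) (Fin r) ℝ}

theorem errorRhs_eq_feedback (t : ℝ) (x : Fin n × Fin N → ℝ) (d : Fin r → ℝ) :
    S.errorRhs α Γ Δ₁ D₂ t x d =
      -(gammaBar Γ *ᵥ ((S.Lambda α t)ᵀ *ᵥ (S.Lambda α t *ᵥ x - D₂ t *ᵥ d))) -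
        D1bar n Δ₁ *ᵥ d := by
  simp only [errorRhs, Matrix.sub_mulVec, Matrix.mulVec_sub, ← Matrix.mulVec_mulVec]
  abel

theorem errorRhs_eq_add (t : ℝ) (x : Fin n × Fin N → ℝ) (d : Fin r → ℝ) :
    S.errorRhs α Γ Δ₁ D₂ t x d =
      (-(gammaBar Γ * S.outputGram α t)) *ᵥ x + S.errorRhs α Γ Δ₁ D₂ t 0 d := by
  simp only [errorRhs, Matrix.mulVec_zero, neg_zero, zero_add, outputGram, Matrix.mul_assoc,
    Matrix.neg_mulVec]

theorem Excited.errorRhs_dotProduct_self_le (hS : S.Excited T ι₁lo ι₁hi r₂ r₃ lam) (hα : 0 ≤ α)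
    (hE : ∀ t, 0 ≤ t → ∀ d, (D₂ t *ᵥ d) ⬝ᵥ (D₂ t *ᵥ d) ≤ E * (d ⬝ᵥ d)) :
    ∃ K, 0 ≤ K ∧ ∀ t, 0 ≤ t → ∀ x d, S.errorRhs α Γ Δ₁ D₂ t x d ⬝ᵥ S.errorRhs α Γ Δ₁ D₂ t x d ≤
      K * (x ⬝ᵥ x + d ⬝ᵥ d) := by
  have hr₄ : 0 ≤ r₂ + α * r₃ := add_nonneg hS.r₂_pos.le (mul_nonneg hα hS.r₃_pos.le)
  set ρ := r₂ + α * r₃ with hρ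
  set k := 6 / 5 * (‖gammaBar Γ‖ ^ 2 * ρ) with hk
  have hk0 : 0 ≤ k := by positivity
  -- When r = 0 the bound on D₂ is vacuous and E may be negative.
  have hE0 : E ≤ |E| := le_abs_self E
  refine ⟨6 / 5 * k * ρ + 6 * k * |E| + 6 * ‖D1bar n Δ₁‖ ^ 2, by positivity,
    fun t ht x d => ?_⟩
  rw [errorRhs_eq_feedback]
  refine (feedback_dotProduct_self_le hr₄ (fun v => hS.outputGram_le hα ht v) le_rfl _ _).trans ?_
  have hx := dotProduct_self_nonneg' x
  have hd := dotProduct_self_nonneg' d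
  have h1 := mulVec_dotProduct_self_le (D1bar n Δ₁) d
  have h2 := add_dotProduct_self_le (S.Lambda α t *ᵥ x) (-(D₂ t *ᵥ d))
  rw [neg_dotProduct_neg, ← sub_eq_add_neg] at h2
  have h3 : (S.Lambda α t *ᵥ x) ⬝ᵥ (S.Lambda α t *ᵥ x) ≤ ρ * (x ⬝ᵥ x) := by
    rw [← quadratic_transpose_mul_self]
    exact hS.outputGram_le hα ht x
  have h4 : (D₂ t *ᵥ d) ⬝ᵥ (D₂ t *ᵥ d) ≤ |E| * (d ⬝ᵥ d) :=
    (hE t ht d).trans (mul_le_mul_of_nonneg_right hE0 hd)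
  have h5 := mul_le_mul_of_nonneg_left (h2.trans (add_le_add
    (mul_le_mul_of_nonneg_left h3 (by norm_num)) (mul_le_mul_of_nonneg_left h4 (by norm_num)))) hk0
  have p1 : 0 ≤ (6 / 5 * k * ρ) * (d ⬝ᵥ d) := by positivity
  have p2 : 0 ≤ (6 * k * |E| + 6 * ‖D1bar n Δ₁‖ ^ 2) * (x ⬝ᵥ x) := by positivity
  rw [← hk]
  linarith

theorem measurable_gain_mul_outputGram (hα : 0 ≤ α) (i j : Fin n × Fin N) :
    Measurable fun t => (-(gammaBar Γ * S.outputGram α t)) i j := by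
  simp only [Matrix.neg_apply, Matrix.mul_apply]
  exact (Finset.measurable_sum _ fun k _ => (S.measurable_outputGram hα k j).const_mul _).neg

theorem MeasurableDisturbance.aestronglyMeasurable_errorRhs (hD₂ : S.MeasurableDisturbance α D₂)
    {δ : ℝ → Fin r → ℝ} (hδ : MemL2 δ) (i : Fin n × Fin N) :
    AEStronglyMeasurable (fun t => S.errorRhs α Γ Δ₁ D₂ t 0 (δ t) i)
      (volume.restrict (Set.Ici 0)) := by
  have e : (fun t => S.errorRhs α Γ Δ₁ D₂ t 0 (δ t) i) = fun t =>
      ∑ k, ((∑ j, gammaBar Γ i j * ((S.Lambda α t)ᵀ * D₂ t) j k) - D1bar n Δ₁ i k) * δ t k := by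
    ext t
    simp only [errorRhs, Matrix.mulVec_zero, neg_zero, zero_add, Matrix.mul_assoc, Matrix.mulVec,
      dotProduct, Matrix.sub_apply]
    simp only [Matrix.mul_apply (M := gammaBar Γ)]
  rw [e]
  refine Finset.aestronglyMeasurable_fun_sum _ fun k _ => ?_
  refine AEStronglyMeasurable.mul ?_ (hδ.1 k)
  exact ((Finset.measurable_sum _ fun j _ => (hD₂.1 j k).const_mul _).sub_const
    _).aestronglyMeasurable

/-- The equation is split into a bounded linear kernel and a forcing b. From b² ≤ R|δ|² follows |b|
≤ 1 + R|δ|², so the integrated forcing grows at most linearly and meets the exponential growth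
condition. -/
theorem Excited.exists_errorTrajectory (hS : S.Excited T ι₁lo ι₁hi r₂ r₃ lam) (hα : 0 ≤ α)
    (hD₂ : S.MeasurableDisturbance α D₂)
    (hE : ∀ t, 0 ≤ t → ∀ d, (D₂ t *ᵥ d) ⬝ᵥ (D₂ t *ᵥ d) ≤ E * (d ⬝ᵥ d))
    (x₀ : Fin n × Fin N → ℝ) {δ : ℝ → Fin r → ℝ} (hδ : MemL2 δ) :
    ∃ x, S.IsErrorTrajectory α Γ Δ₁ D₂ x₀ δ x := by
  obtain ⟨R, hR0, hR⟩ := hS.errorRhs_dotProduct_self_le (Γ := Γ) (Δ₁ := Δ₁) hα hE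
  set b : ℝ → Fin n × Fin N → ℝ := fun t => S.errorRhs α Γ Δ₁ D₂ t 0 (δ t) with hb
  set A : ℝ → Matrix (Fin n × Fin N) (Fin n × Fin N) ℝ :=
    fun t => -(gammaBar Γ * S.outputGram α t) with hAdef
  have coord_sq_le : ∀ (v : Fin n × Fin N → ℝ) i, v i ^ 2 ≤ v ⬝ᵥ v := by
    intro v i
    rw [sq]
    exact Finset.single_le_sum (f := fun j => v j * v j) (fun j _ => mul_self_nonneg (v j))
      (Finset.mem_univ i)
  have hb_le : ∀ t, 0 ≤ t → ∀ i, |b t i| ≤ 1 + R * (δ t ⬝ᵥ δ t) := by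
    intro t ht i
    have h1 := hR t ht 0 (δ t)
    rw [dotProduct_zero, zero_add] at h1
    have h2 := (coord_sq_le (b t) i).trans h1
    rw [← sq_abs] at h2
    nlinarith [sq_nonneg (|b t i| - 1), abs_nonneg (b t i)]
  have hgi : ∀ t, 0 ≤ t → IntervalIntegrable (fun s => 1 + R * (δ s ⬝ᵥ δ s)) volume 0 t :=
    fun t ht => IntervalIntegrable.add (by simp) ((hδ.intervalIntegrable ht).const_mul R)
  have hbi : ∀ t, 0 ≤ t → ∀ i, IntervalIntegrable (fun s => b s i) volume 0 t := by
    intro t ht i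
    refine (hgi t ht).mono_fun' ?_ ?_
    · refine (hD₂.aestronglyMeasurable_errorRhs hδ i).mono_measure (Measure.restrict_mono ?_ le_rfl)
      rw [Set.uIoc_of_le ht]
      exact Set.Ioc_subset_Icc_self.trans Set.Icc_subset_Ici_self
    · rw [Set.uIoc_of_le ht]
      filter_upwards [ae_restrict_mem measurableSet_Ioc] with s hs
      exact hb_le s hs.1.le i
  -- The cardinality passes from the Euclidean bound to the sup norm of the Volterra equation. The
  -- kernel constant 1 + c is positive even if R = 0.
  set c : ℝ := Real.sqrt (R * Fintype.card (Fin n × Fin N)) with hc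
  have hAK : ∀ t, 0 ≤ t → ∀ v : Fin n × Fin N → ℝ, ‖A t *ᵥ v‖ ≤ (1 + c) * ‖v‖ := by
    intro t ht v
    refine (pi_norm_le_iff_of_nonneg (by positivity)).2 fun i => ?_
    have h1 := hR t ht v 0
    rw [errorRhs_eq_add] at h1
    have h0 : S.errorRhs α Γ Δ₁ D₂ t 0 0 = 0 := by simp [errorRhs]
    rw [h0, add_zero, dotProduct_zero, add_zero] at h1
    have h2 := (coord_sq_le (A t *ᵥ v) i).trans h1
    have h3 : v ⬝ᵥ v ≤ Fintype.card (Fin n × Fin N) * ‖v‖ ^ 2 := by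
      have : v ⬝ᵥ v ≤ ∑ _i : Fin n × Fin N, ‖v‖ ^ 2 := by
        refine Finset.sum_le_sum fun j _ => ?_
        rw [← sq, ← sq_abs]
        exact pow_le_pow_left₀ (abs_nonneg _) (norm_le_pi_norm v j) 2
      simpa using this
    have h4 : (A t *ᵥ v) i ^ 2 ≤ (c * ‖v‖) ^ 2 := by
      rw [mul_pow, hc, Real.sq_sqrt (by positivity)]
      refine h2.trans ?_
      have := mul_le_mul_of_nonneg_left h3 hR0
      linarith
    have h5 := abs_le_of_sq_le_sq h4 (by positivity)
    rw [Real.norm_eq_abs]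
    nlinarith [norm_nonneg v]
  set β : ℝ → Fin n × Fin N → ℝ := fun t i => x₀ i + ∫ s in (0 : ℝ)..t, b s i with hβ
  have hβc : ContinuousOn β (Set.Ici 0) := continuousOn_pi.2 fun i =>
    continuousOn_Ici_of_eq_primitive (f := fun s => b s i) (c := x₀ i) (fun t ht => hbi t ht i)
      fun t _ => rfl
  set D := ∫ s in Set.Ici (0 : ℝ), δ s ⬝ᵥ δ s with hD
  have hD0 : 0 ≤ D := integral_nonneg fun s => dotProduct_self_nonneg' _
  have hβC : ∀ t, 0 ≤ t → ‖β t‖ ≤ (‖x₀‖ + 1 + R * D) * Real.exp (2 * (1 + c) * t) := by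
    intro t ht
    have hc0 : 0 ≤ c := Real.sqrt_nonneg _
    have hexp1 : t + 1 ≤ Real.exp (2 * (1 + c) * t) := by
      refine le_trans ?_ (Real.add_one_le_exp _)
      nlinarith [mul_nonneg hc0 ht]
    refine (pi_norm_le_iff_of_nonneg (by positivity)).2 fun i => ?_
    have h1 : ‖∫ s in (0 : ℝ)..t, b s i‖ ≤ ∫ s in (0 : ℝ)..t, (1 + R * (δ s ⬝ᵥ δ s)) :=
      intervalIntegral.norm_integral_le_of_norm_le ht
        (Filter.Eventually.of_forall fun s hs => hb_le s hs.1.le i) (hgi t ht)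
    rw [intervalIntegral.integral_add (by simp) ((hδ.intervalIntegrable ht).const_mul R),
      intervalIntegral.integral_const_mul, intervalIntegral.integral_const, smul_eq_mul, mul_one,
      sub_zero] at h1
    have h2 := mul_le_mul_of_nonneg_left (hδ.integral_le ht) hR0
    have h3 : ‖β t i‖ ≤ ‖x₀‖ + (t + R * D) :=
      (norm_add_le _ _).trans (add_le_add (norm_le_pi_norm x₀ i) (by linarith))
    have h4 : 0 ≤ ‖x₀‖ := norm_nonneg _
    have h5 : 0 ≤ R * D := by positivity
    nlinarith
  obtain ⟨x, -, hx⟩ := exists_volterra A (fun i j => measurable_gain_mul_outputGram hα i j)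
    (by positivity : 0 < 1 + c) hAK hβc hβC
  refine ⟨x, fun t ht i => ?_⟩
  obtain ⟨hAi, hxe⟩ := hx t ht
  have hAii : IntervalIntegrable (fun s => (A s *ᵥ x s) i) volume 0 t :=
    ⟨(ContinuousLinearMap.proj (R := ℝ) (φ := fun _ : Fin n × Fin N => ℝ) i).integrable_comp hAi.1,
      (ContinuousLinearMap.proj (R := ℝ) (φ := fun _ : Fin n × Fin N => ℝ) i).integrable_comp hAi.2⟩
  have e : ∀ s, S.errorRhs α Γ Δ₁ D₂ s (x s) (δ s) i = (A s *ᵥ x s) i + b s i := by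
    intro s
    rw [errorRhs_eq_add]
    rfl
  simp only [e]
  refine ⟨hAii.add (hbi t ht i), ?_⟩
  rw [intervalIntegral.integral_add hAii (hbi t ht i), hxe, Pi.add_apply]
  have h := (ContinuousLinearMap.proj (R := ℝ) (φ := fun _ : Fin n × Fin N => ℝ)
    i).intervalIntegral_comp_comm hAi
  simp only [ContinuousLinearMap.proj_apply] at h
  rw [← h, hβ]
  ring

end SensorNetwork

/-! ### The integral estimate along a trajectory. -/

namespace SensorNetwork

variable {n N Ny r : ℕ} {S : SensorNetwork n N Ny} {T ι₁lo ι₁hi r₂ r₃ lam α : ℝ}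
  {Γ : Fin n → Matrix (Fin N) (Fin N) ℝ} {Δ₁ : Matrix (Fin N) (Fin r) ℝ}
  {D₂ : ∀ t, Matrix (S.Out t) (Fin r) ℝ}

/-- The lower and the upper bound of the Gram form over [0, T] are compared on a unit vector. -/
theorem Excited.iota2lo_le_iota2hi (hS : S.Excited T ι₁lo ι₁hi r₂ r₃ lam) (hn : 0 < n) (hN : 0 < N)
    (hα : 0 ≤ α) : iota2lo n N T ι₁lo r₂ lam α ≤ T * (r₂ + α * r₃) := by
  set ξ : Fin n × Fin N → ℝ := Pi.single (⟨0, hn⟩, ⟨0, hN⟩) 1 with hξ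
  have hξξ : ξ ⬝ᵥ ξ = 1 := by simp [hξ]
  have h1 := hS.outputGram_window hn hN hα le_rfl ξ
  have h2 : ∫ s in (T - T)..T, ξ ⬝ᵥ (S.outputGram α s *ᵥ ξ) ≤
      ∫ s in (T - T)..T, (r₂ + α * r₃) * (ξ ⬝ᵥ ξ) := by
    rw [sub_self]
    exact intervalIntegral.integral_mono_on hS.T_pos.le
      (hS.intervalIntegrable_outputGram hα le_rfl hS.T_pos.le ξ) (by simp)
      fun s hs => hS.outputGram_le hα hs.1 ξ
  rw [intervalIntegral.integral_const, hξξ, smul_eq_mul] at h2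
  rw [hξξ] at h1
  linarith

/-- Ensures that the first diagonal block of the tuning matrix is not empty, so that c₂T ≤ c₁ can be
read off it. Without output coordinates the regressors could not be exciting. -/
theorem Excited.nonempty_out (hS : S.Excited T ι₁lo ι₁hi r₂ r₃ lam) (hn : 0 < n) (hN : 0 < N)
    (t : ℝ) : Nonempty (S.Out t) := by
  rcases Nat.eq_zero_or_pos Ny with h | h
  · exfalso
    subst h
    have h1 := hS.regressor_window le_rfl (Pi.single ⟨0, hN⟩ 1)
    have h2 : ∀ i s, (S.C i s)ᵀ * S.C i s = 0 := fun i s => by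
      ext a b; simp [Matrix.mul_apply]
    simp only [h2, Matrix.zero_mulVec, dotProduct_zero, Finset.sum_const_zero,
      intervalIntegral.integral_zero] at h1
    have := hS.ι₁lo_pos
    simp at h1
    linarith
  · exact ⟨Sum.inl (⟨0, hn⟩, ⟨0, h⟩)⟩

theorem Excited.integral_errorTrajectory_le (hS : S.Excited T ι₁lo ι₁hi r₂ r₃ lam) (hn : 0 < n)
    (hN : 0 < N) (hα : 0 ≤ α) {r₁ r₄ ι₃ c₁ c₂ γ γ₂ E : ℝ} (hr₄ : r₄ = r₂ + α * r₃)
    (hι : 0 < ι₃) (hι₃ : ι₃ = iota3lo r₁ (iota2lo n N T ι₁lo r₂ lam α) (iota2hi T r₄))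
    (hc₂ : 0 < c₂) (hc : c₂ * T ≤ c₁) (hγ₂ : 0 < γ₂) (hr₁ : ‖gammaBar Γ‖ ≤ r₁)
    (hΓ : (gammaBar Γ
      - Real.sqrt γ₂ • (1 : Matrix (Fin n × Fin N) (Fin n × Fin N) ℝ)).PosSemidef)
    (hE : ∀ t, 0 ≤ t → ∀ d, (D₂ t *ᵥ d) ⬝ᵥ (D₂ t *ᵥ d) ≤ E * (d ⬝ᵥ d))
    (hdis : ∀ t, 0 ≤ t → ∀ d, c₁ * ((D₂ t *ᵥ d) ⬝ᵥ (D₂ t *ᵥ d)) +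
      4 * c₁ ^ 2 / (c₂ * ι₃ * γ₂) * ((D1bar n Δ₁ *ᵥ d) ⬝ᵥ (D1bar n Δ₁ *ᵥ d)) ≤
        (γ - 1) * (d ⬝ᵥ d))
    {x₀ : Fin n × Fin N → ℝ} {δ : ℝ → Fin r → ℝ} (hδ : MemL2 δ) {x : ℝ → Fin n × Fin N → ℝ}
    (hx : S.IsErrorTrajectory α Γ Δ₁ D₂ x₀ δ x) {τ : ℝ} (hτ : 0 ≤ τ) :
    IntervalIntegrable (fun s => x s ⬝ᵥ x s) volume 0 τ ∧
    c₂ * ι₃ / 2 * ∫ s in (0 : ℝ)..τ, x s ⬝ᵥ x s ≤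
      c₁ * (x₀ ⬝ᵥ ((gammaBar Γ)⁻¹ *ᵥ x₀)) + c₁ * (T * r₄ * (x₀ ⬝ᵥ x₀)) +
        (γ - 1) * ∫ s in (0 : ℝ)..τ, δ s ⬝ᵥ δ s := by
  have : Nonempty (Fin n × Fin N) := ⟨(⟨0, hn⟩, ⟨0, hN⟩)⟩
  have hT := hS.T_pos
  have hr₄0 : 0 < r₄ := by
    rw [hr₄]; exact add_pos_of_pos_of_nonneg hS.r₂_pos (mul_nonneg hα hS.r₃_pos.le)
  have hc₁ : 0 < c₁ := (mul_pos hc₂ hT).trans_le hc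
  have hγs : 0 < Real.sqrt γ₂ := Real.sqrt_pos.2 hγ₂
  have hγr : Real.sqrt γ₂ ≤ r₁ := (le_norm_of_sub_smul_one hΓ).trans hr₁
  have hr₁0 : 0 < r₁ := hγs.trans_le hγr
  have hγr2 : γ₂ ≤ r₁ ^ 2 := by
    rw [← Real.sq_sqrt hγ₂.le]; exact pow_le_pow_left₀ hγs.le hγr 2
  set l := iota2lo n N T ι₁lo r₂ lam α with hl
  have hl0 : 0 ≤ l := iota2lo_nonneg hα hS.lam_pos.le
  have hlh : l ≤ T * r₄ := by rw [hr₄]; exact hS.iota2lo_le_iota2hi hn hN hα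
  set σ := Real.sqrt (phi1 r₁ (iota2hi T r₄)) with hσ
  have hφ : 0 < phi1 r₁ (iota2hi T r₄) := by
    unfold phi1 iota2hi; positivity
  have hσ0 : 0 < σ := Real.sqrt_pos.2 hφ
  have hσ2 : σ ^ 2 = 1 / 2 * r₁ ^ 2 * (T * r₄) ^ 2 := Real.sq_sqrt hφ.le
  have hιl : ι₃ * (1 + σ) ^ 2 ≤ l := by
    rw [hι₃]
    exact iota3lo_le hl0 hlh (by unfold iota2hi; positivity)
  have hx0 : x 0 = x₀ := by
    ext i
    have := (hx 0 le_rfl i).2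
    simpa using this
  set f : ℝ → Fin n × Fin N → ℝ := fun s => S.errorRhs α Γ Δ₁ D₂ s (x s) (δ s) with hf
  have hfi : ∀ t, 0 ≤ t → ∀ i, IntervalIntegrable (fun s => f s i) volume 0 t :=
    fun t ht i => (hx t ht i).1
  have hxi : ∀ i, ∀ t ∈ Set.Icc 0 τ, x t i = x 0 i + ∫ s in (0 : ℝ)..t, f s i := by
    intro i t ht
    rw [hx0]
    exact (hx t ht.1 i).2
  have hxc : ∀ i, ContinuousOn (fun t => x t i) (Set.Icc 0 τ) := fun i =>
    continuousOn_of_eq_primitive hτ (hfi τ hτ i) (hxi i)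
  have hxx : IntervalIntegrable (fun s => x s ⬝ᵥ x s) volume 0 τ := by
    refine intervalIntegrable_dotProduct_self fun i => ContinuousOn.intervalIntegrable ?_
    rw [Set.uIcc_of_le hτ]
    exact (hxc i).pow 2
  have hδδ := hδ.intervalIntegrable hτ
  obtain ⟨K, hK0, hK⟩ := hS.errorRhs_dotProduct_self_le (Γ := Γ) (Δ₁ := Δ₁) hα hE
  -- The velocity is square integrable because |f|² ≤ K(|x|² + |δ|²), with x continuous and δ in L₂.
  have hf2 : ∀ i, IntervalIntegrable (fun s => f s i ^ 2) volume 0 τ := by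
    intro i
    refine IntervalIntegrable.mono_fun' ((hxx.add hδδ).const_mul K) ?_ ?_
    · have := (hfi τ hτ i).def'.aestronglyMeasurable
      exact this.pow 2
    · rw [Set.uIoc_of_le hτ]
      filter_upwards [ae_restrict_mem measurableSet_Ioc] with s hs
      rw [Real.norm_of_nonneg (sq_nonneg _), sq]
      exact (Finset.single_le_sum (f := fun j => f s j * f s j)
        (fun j _ => mul_self_nonneg (f s j)) (Finset.mem_univ i)).trans (hK s hs.1.le _ _)
  have hff := intervalIntegrable_dotProduct_self hf2
  have hq : IntervalIntegrable (fun s => x s ⬝ᵥ (S.outputGram α s *ᵥ x s)) volume 0 τ := by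
    refine IntervalIntegrable.mono_fun' (hxx.const_mul r₄) ?_ ?_
    · rw [Set.uIoc_of_le hτ]
      simp only [quadratic_eq_sum]
      have hxm : ∀ i, AEStronglyMeasurable (fun s => x s i) (volume.restrict (Set.Ioc 0 τ)) :=
        fun i => ((hxc i).mono Set.Ioc_subset_Icc_self).aestronglyMeasurable measurableSet_Ioc
      exact Finset.aestronglyMeasurable_fun_sum _ fun i _ =>
        Finset.aestronglyMeasurable_fun_sum _ fun j _ =>
          (S.measurable_outputGram hα i j).aestronglyMeasurable.mul ((hxm i).mul (hxm j))
    · rw [Set.uIoc_of_le hτ]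
      filter_upwards [ae_restrict_mem measurableSet_Ioc] with s hs
      rw [Real.norm_of_nonneg ((S.posSemidef_outputGram α s).quadratic_nonneg _), hr₄]
      exact hS.outputGram_le hα hs.1.le _
  have hpd := posDef_of_sub_smul_one hγs hΓ
  obtain ⟨hVi, hV⟩ := quadratic_sub_eq_integral (gammaBar Γ)⁻¹ hpd.isHermitian.inv hτ
    (hfi τ hτ) hxi
  have hVτ : 0 ≤ x τ ⬝ᵥ ((gammaBar Γ)⁻¹ *ᵥ x τ) := hpd.posSemidef.inv.quadratic_nonneg _
  set κ := σ / (1 + σ) with hκ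
  have hκ0 : 0 ≤ κ := by positivity
  have hκ1 : κ ≤ 1 := by rw [hκ, div_le_one (by positivity)]; linarith
  have hκw := weight_le hσ0.le hT hr₄0 hc₂ hι hlh hιl hc hγ₂ hγr2
  rw [← hκ] at hκw
  set μ := 5 * κ * c₁ / (r₁ ^ 2 * r₄) / 6 with hμ
  have hμ0 : 0 ≤ μ := by positivity
  have henergy := intervalIntegral.integral_mono_on hτ
    ((hVi.const_mul c₁).add ((hq.const_mul c₁).add (hff.const_mul μ)))
    ((hxx.const_mul (1 / 3 * (c₂ * ι₃))).add (hδδ.const_mul (γ - 1))) fun s hs =>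
      dissipation_le hr₄0 hr₁0
        (fun v => by rw [hr₄]; exact hS.outputGram_le hα hs.1 v) hr₁ hΓ hc₁ hc₂ hι hγ₂ hκ0 hκ1
        hκw (x s) (D1bar n Δ₁ *ᵥ δ s) (D₂ s *ᵥ δ s) (hdis s hs.1 (δ s)) (f s)
        (errorRhs_eq_feedback s (x s) (δ s))
  rw [intervalIntegral.integral_add (hVi.const_mul c₁) ((hq.const_mul c₁).add (hff.const_mul μ)),
    intervalIntegral.integral_add (hq.const_mul c₁) (hff.const_mul μ),
    intervalIntegral.integral_add (hxx.const_mul _) (hδδ.const_mul _),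
    intervalIntegral.integral_const_mul c₁, intervalIntegral.integral_const_mul c₁,
    intervalIntegral.integral_const_mul μ, intervalIntegral.integral_const_mul (1 / 3 * (c₂ * ι₃)),
    intervalIntegral.integral_const_mul (γ - 1), ← hV, hx0] at henergy
  obtain ⟨-, hwindow⟩ := integral_quadratic_le_of_window (l := l) (ρ := r₄) hT hσ0 hr₄0.le hτ
    (S.posSemidef_outputGram α) (fun s hs ξ => by rw [hr₄]; exact hS.outputGram_le hα hs ξ)
    (fun ξ t ht => hS.intervalIntegrable_outputGram hα le_rfl ht ξ)
    (fun t ht ξ => hS.outputGram_window hn hN hα ht ξ) (hfi τ hτ) hf2 hxi hq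
  rw [hx0] at hwindow
  refine ⟨hxx, ?_⟩
  refine energy_add_window_le hσ0 hT hr₄0 hr₁0 hc₂ hσ2 hιl hc hμ
    (intervalIntegral.integral_nonneg hτ fun s _ => dotProduct_self_nonneg' _)
    (intervalIntegral.integral_nonneg hτ fun s _ =>
      (S.posSemidef_outputGram α s).quadratic_nonneg _)
    (intervalIntegral.integral_nonneg hτ fun s _ => dotProduct_self_nonneg' _)
    (dotProduct_self_nonneg' x₀) ?_ hwindow
  -- The terminal storage is nonnegative and is dropped; only the initial storage remains.
  have hcV : 0 ≤ c₁ * (x τ ⬝ᵥ ((gammaBar Γ)⁻¹ *ᵥ x τ)) := mul_nonneg hc₁.le hVτ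
  change c₁ * (_ - _) + (c₁ * (∫ s in (0 : ℝ)..τ, x s ⬝ᵥ (S.outputGram α s *ᵥ x s)) + _) ≤ _
    at henergy
  linarith

end SensorNetwork

theorem theorem2 {n N Ny r p : ℕ} (hn : 0 < n) (hN : 0 < N)
    (S : SensorNetwork n N Ny)
    (T ι₁lo ι₁hi r₂ r₃ lam : ℝ) (hS : S.Excited T ι₁lo ι₁hi r₂ r₃ lam)
    (γ α : ℝ) (hγ : 0 < γ) (hα : 0 < α)
    (Δ₁ : Matrix (Fin N) (Fin r) ℝ) (D₂ : ∀ t, Matrix (S.Out t) (Fin r) ℝ)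
    (hD₂ : S.MeasurableDisturbance α D₂)
    (Q : Matrix (Fin p) (Fin n × Fin N) ℝ) (W : Matrix (Fin p) (Fin r) ℝ)
    (hW : Wᵀ * W = 1) (hQW : Qᵀ * W = 0)
    (r₁ r₄ ι₂lo ι₂hi ι₃lo ι₃hi : ℝ)
    (hr₄ : r₄ = r₂ + α * r₃)
    (hι₂lo : ι₂lo = iota2lo n N T ι₁lo r₂ lam α) (hι₂hi : ι₂hi = iota2hi T r₄)
    (hι₃lo : ι₃lo = iota3lo r₁ ι₂lo ι₂hi) (hι₃hi : ι₃hi = iota3hi r₁ ι₂lo ι₂hi)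
    (c₂ : ℝ) (hc₂ : 0 < c₂)
    (hc₂Q : (Matrix.fromBlocks
      ((c₂ * ι₃lo / 2) • (1 : Matrix (Fin n × Fin N) (Fin n × Fin N) ℝ)) (-Qᵀ)
      (-Q) (1 : Matrix (Fin p) (Fin p) ℝ)).PosDef)
    (c₁ γ₁ γ₂ : ℝ) (hc₁ : 0 < c₁) (hγ₁ : 0 < γ₁) (hγ₂ : 0 < γ₂) (hγ₁₂ : γ₂ ≤ γ₁)
    (hLMI : ∀ t, 0 ≤ t →
      (-tuningMatrix T γ γ₁ γ₂ c₁ c₂ ι₃lo ι₃hi r₄ (D1bar n Δ₁) (D₂ t) Q W).PosSemidef)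
    (Γ : Fin n → Matrix (Fin N) (Fin N) ℝ)
    (hr₁ : ‖gammaBar Γ‖ ≤ r₁)
    (hΓ_upper : (Real.sqrt γ₁ • (1 : Matrix (Fin n × Fin N) (Fin n × Fin N) ℝ)
      - gammaBar Γ).PosSemidef)
    (hΓ_lower : (gammaBar Γ
      - Real.sqrt γ₂ • (1 : Matrix (Fin n × Fin N) (Fin n × Fin N) ℝ)).PosSemidef)
    (x₀ : Fin n × Fin N → ℝ) :
    (∀ δ, MemL2 δ → ∃ z, S.ErrorSystem α Γ Δ₁ D₂ Q W x₀ δ z) ∧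
      l2Gain (S.ErrorSystem α Γ Δ₁ D₂ Q W x₀) ≤ ENNReal.ofReal (Real.sqrt γ) := by
  have hT := hS.T_pos
  have hr₄0 : 0 < r₄ := by
    rw [hr₄]; exact add_pos_of_pos_of_nonneg hS.r₂_pos (mul_nonneg hα.le hS.r₃_pos.le)
  -- From its definition ι₂lo is only known to be nonnegative here; strict positivity of ι₃lo is
  -- read off a diagonal entry of the positive definite matrix.
  have hι : 0 < ι₃lo := by
    have h := hc₂Q.diag_pos (i := Sum.inl (⟨0, hn⟩, ⟨0, hN⟩))
    simp only [Matrix.fromBlocks_apply₁₁, Matrix.smul_apply, Matrix.one_apply_eq, smul_eq_mul,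
      mul_one] at h
    exact pos_of_mul_pos_right (by linarith : 0 < c₂ * ι₃lo) hc₂.le
  have hQ : ∀ v, (Q *ᵥ v) ⬝ᵥ (Q *ᵥ v) ≤ c₂ * ι₃lo / 2 * (v ⬝ᵥ v) := hc₂Q.block_le
  have hc : c₂ * T ≤ c₁ := by
    have := hS.nonempty_out hn hN 0
    exact gain_le_of_tuningMatrix (hLMI 0 le_rfl)
  have hdis := fun t ht d => dissipation_of_tuningMatrix hW hc₂ hι hr₄0.le hγ₁.le hγ₂ (hLMI t ht) d
  -- The matrix inequality itself bounds D̄₂ uniformly in time, which existence of solutions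
  -- requires.
  have hE : ∀ t, 0 ≤ t → ∀ d, (D₂ t *ᵥ d) ⬝ᵥ (D₂ t *ᵥ d) ≤ (γ - 1) / c₁ * (d ⬝ᵥ d) := by
    intro t ht d
    have h1 := hdis t ht d
    have h2 : 0 ≤ 4 * c₁ ^ 2 / (c₂ * ι₃lo * γ₂) *
        ((D1bar n Δ₁ *ᵥ d) ⬝ᵥ (D1bar n Δ₁ *ᵥ d)) :=
      mul_nonneg (by positivity) (dotProduct_self_nonneg' _)
    rw [div_mul_eq_mul_div, le_div_iff₀ hc₁]
    linarith
  constructor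
  · intro δ hδ
    obtain ⟨x, hx⟩ := hS.exists_errorTrajectory (Γ := Γ) (Δ₁ := Δ₁) hα.le hD₂ hE x₀ hδ
    exact ⟨_, x, hx, rfl⟩
  have hΓinv : 0 ≤ x₀ ⬝ᵥ ((gammaBar Γ)⁻¹ *ᵥ x₀) :=
    (posDef_of_sub_smul_one (Real.sqrt_pos.2 hγ₂) hΓ_lower).posSemidef.inv.quadratic_nonneg _
  set B := c₁ * (x₀ ⬝ᵥ ((gammaBar Γ)⁻¹ *ᵥ x₀)) + c₁ * (T * r₄ * (x₀ ⬝ᵥ x₀)) with hB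
  have hB0 : 0 ≤ B := by
    have := dotProduct_self_nonneg' x₀
    positivity
  -- The offset √B depends on the initial value but not on δ, so √γ is admissible in the infimum.
  refine iInf₂_le (Real.toNNReal (Real.sqrt γ)) ⟨Real.toNNReal (Real.sqrt B), ?_⟩
  rintro δ z hδ ⟨x, hx, rfl⟩
  rw [Real.coe_toNNReal _ (Real.sqrt_nonneg _), Real.coe_toNNReal _ (Real.sqrt_nonneg _)]
  have hmain := fun τ (hτ : 0 ≤ τ) => hS.integral_errorTrajectory_le hn hN hα.le hr₄ hι
    (by rw [hι₃lo, hι₂lo, hι₂hi]) hc₂ hc hγ₂ hr₁ hΓ_lower hE hdis hδ hx hτ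
  have hzz : ∀ s, (Q *ᵥ x s + W *ᵥ δ s) ⬝ᵥ (Q *ᵥ x s + W *ᵥ δ s) =
      (Q *ᵥ x s) ⬝ᵥ (Q *ᵥ x s) + δ s ⬝ᵥ δ s := by
    intro s
    have h1 : (Q *ᵥ x s) ⬝ᵥ (W *ᵥ δ s) = 0 := by
      rw [← Matrix.vecMul_transpose, ← Matrix.dotProduct_mulVec, Matrix.mulVec_mulVec, hQW,
        Matrix.zero_mulVec, dotProduct_zero]
    have h2 : (W *ᵥ δ s) ⬝ᵥ (W *ᵥ δ s) = δ s ⬝ᵥ δ s := by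
      rw [← quadratic_transpose_mul_self, hW, Matrix.one_mulVec]
    rw [add_dotProduct, dotProduct_add, dotProduct_add, dotProduct_comm (W *ᵥ δ s) (Q *ᵥ x s), h1,
      h2]
    ring
  have hxc : ∀ i, ContinuousOn (fun t => x t i) (Set.Ici 0) := fun i =>
    continuousOn_Ici_of_eq_primitive (fun t ht => (hx t ht i).1) fun t ht => (hx t ht i).2
  have hzm : ∀ i, AEStronglyMeasurable (fun t => (Q *ᵥ x t + W *ᵥ δ t) i)
      (volume.restrict (Set.Ici 0)) := by
    intro i
    simp only [Pi.add_apply, Matrix.mulVec, dotProduct]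
    refine AEStronglyMeasurable.add ?_ ?_
    · exact Finset.aestronglyMeasurable_fun_sum _ fun j _ =>
        ((hxc j).aestronglyMeasurable measurableSet_Ici).const_mul _
    · exact Finset.aestronglyMeasurable_fun_sum _ fun j _ => (hδ.1 j).const_mul _
  have hbound : ∀ s, (Q *ᵥ x s + W *ᵥ δ s) ⬝ᵥ (Q *ᵥ x s + W *ᵥ δ s) ≤
      c₂ * ι₃lo / 2 * (x s ⬝ᵥ x s) + δ s ⬝ᵥ δ s := fun s => by
    rw [hzz]; exact add_le_add_left (hQ _) _
  have hzi : ∀ t, 0 ≤ t → IntervalIntegrable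
      (fun s => (Q *ᵥ x s + W *ᵥ δ s) ⬝ᵥ (Q *ᵥ x s + W *ᵥ δ s)) volume 0 t := by
    intro t ht
    refine IntervalIntegrable.mono_fun' (((hmain t ht).1.const_mul (c₂ * ι₃lo / 2)).add
      (hδ.intervalIntegrable ht)) ?_ (Filter.Eventually.of_forall fun s => ?_)
    · simp only [dotProduct]
      refine Finset.aestronglyMeasurable_fun_sum _ fun i _ => ?_
      have := (hzm i).mono_measure (Measure.restrict_mono (s := Set.uIoc 0 t) (by
        rw [Set.uIoc_of_le ht]
        exact Set.Ioc_subset_Icc_self.trans Set.Icc_subset_Ici_self) le_rfl)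
      exact this.mul this
    · exact (Real.norm_of_nonneg (dotProduct_self_nonneg' _)).trans_le (hbound s)
  have hzB : ∀ t, 0 ≤ t → ∫ s in (0 : ℝ)..t,
      (Q *ᵥ x s + W *ᵥ δ s) ⬝ᵥ (Q *ᵥ x s + W *ᵥ δ s) ≤
        B + γ * ∫ s in Set.Ici (0 : ℝ), δ s ⬝ᵥ δ s := by
    intro t ht
    obtain ⟨hxx, hle⟩ := hmain t ht
    have hδδ := hδ.intervalIntegrable ht
    have h1 := intervalIntegral.integral_mono_on ht (hzi t ht) ((hxx.const_mul _).add hδδ)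
      fun s _ => hbound s
    rw [intervalIntegral.integral_add (hxx.const_mul _) hδδ,
      intervalIntegral.integral_const_mul] at h1
    have h2 := mul_le_mul_of_nonneg_left (hδ.integral_le ht) hγ.le
    linarith
  obtain ⟨hz, hzle⟩ := MemL2.of_integral_le hzm hzi hzB
  exact ⟨hz, l2norm_le_of_integral_le hγ.le hB0 hzle⟩
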